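/- **Setting.** All groups are abelian and written additively, and all ground sets are finite. For a labeling $\psi\colon E\to\Gamma$ and $S\subseteq E$ put $\psi(S)=\sum_{x\in S}\psi(x)$. A *common basis* of two matroids $M_1,M_2$ on the same ground set $E$ is a set that is a basis of both; it is called *zero* if its label is $0$ and *non-zero* otherwise. For a common basis $B$, the exchange digraph $D_{M_1,M_2}(B)$ has vertex set $E$ and the following labeled arcs: for $x\in B$ and $y\in E\setminus B$ there is an arc $xy$ with label $\psi(y)$ if $B-x+y$ is a basis of $M_1$, and an arc $yx$ with label $-\psi(x)$ if $B-x+y$ is a basis of $M_2$. A directed cycle (of length two or more, with distinct vertices) is *non-zero* if the sum of the labels of its arcs is not $0$. In the problem *Non-Zero Common Basis* we are given two matroids $M_1,M_2$ on a common ground set $E$ and a labeling $\psi\colon E\to\Gamma$, and we are to find a non-zero common basis or to correctly report that none exists. **Theorem.** Let $\Gamma$ be a group that has no element of order two. 1. Let $M_1,M_2$ be matroids on a common ground set $E$, let $\psi\colon E\to\Gamma$ be a labeling and let $B_0$ be a zero common basis of $M_1,M_2$. Then $M_1,M_2$ have a non-zero common basis if and only if $D_{M_1,M_2}(B_0)$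 contains a non-zero directed cycle. 2. Non-Zero Common Basis is solvable in polynomial time when the matroids are given by independence oracles and the group by oracles for its operations (zero, addition, negation) and a zero test: there are one program and one polynomial $p$ such that, for every group $\Gamma$ without an element of order two and every instance $(M_1,M_2,\psi\colon E\to\Gamma)$, the program solves the instance using at most $p(|E|)$ elementary steps, group operations, zero tests and independence oracle calls in total. -/

import Mathlib

universe u v

/-! ### Common bases and the exchange digraph -/

/-- `B` is a common basis of `M₁` and `M₂`. -/
def IsCommonBasis {E : Type*} (M₁ M₂ : Matroid E) (B : Finset E) : Prop :=
  M₁.IsBase (B : Set E) ∧ M₂.IsBase (B : Set E)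

/-- The label `ψ(S)` of a set `S`, the sum of the labels of its elements. -/
def setLabel {E Γ : Type*} [AddCommGroup Γ] (ψ : E → Γ) (S : Finset E) : Γ :=
  ∑ x ∈ S, ψ x

/-- `B` is a common basis of `M₁` and `M₂` whose label is not zero. -/
def IsNonZeroCommonBasis {E Γ : Type*} [AddCommGroup Γ] (M₁ M₂ : Matroid E) (ψ : E → Γ)
    (B : Finset E) : Prop :=
  IsCommonBasis M₁ M₂ B ∧ setLabel ψ B ≠ 0

/-- The exchange digraph of a common basis `B`. For `x ∈ B` and `y ∉ B` there is an arc from `x`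
to `y` if `B - x + y` is a basis of `M₁`, and an arc from `y` to `x` if `B - x + y` is a basis
of `M₂`. -/
def exchangeDigraph {E : Type*} (M₁ M₂ : Matroid E) (B : Finset E) : Digraph E where
  Adj u v :=
    (u ∈ B ∧ v ∉ B ∧ M₁.IsBase (insert v ((B : Set E) \ {u}))) ∨
      (u ∉ B ∧ v ∈ B ∧ M₂.IsBase (insert u ((B : Set E) \ {v})))

/-- The label of an arc from `u` to `v` of the exchange digraph: with `x ∈ B` and `y ∉ B`, an arc
from `x` to `y` has label `ψ y` and an arc from `y` to `x` has label `-ψ x`. -/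
def exchangeLabel {E Γ : Type*} [DecidableEq E] [AddCommGroup Γ] (ψ : E → Γ) (B : Finset E)
    (u v : E) : Γ :=
  if u ∈ B then ψ v else -ψ v

/-- The distinct vertices `c 0, …, c k` form, in this order, a directed cycle of `D`. The addition
in `Fin (k + 1)` is cyclic, so the last arc goes from `c k` to `c 0`. -/
def IsDirectedCycle {V : Type*} (D : Digraph V) {k : ℕ} (c : Fin (k + 1) → V) : Prop :=
  Function.Injective c ∧ ∀ i, D.Adj (c i) (c (i + 1))

/-- The label of a directed cycle, the sum of the labels of its arcs. -/
def cycleLabel {V Γ : Type*} [AddCommGroup Γ] (lab : V → V → Γ) {k : ℕ}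
    (c : Fin (k + 1) → V) : Γ :=
  ∑ i, lab (c i) (c (i + 1))

/-! ### Programs with group and independence oracles

A program works on arrays of natural numbers and on arrays of group elements. Arrays are named by
numbers that are fixed in the program, and their cells are addressed by computed indices. The group
elements can be accessed only through the group operations and a zero test, and the matroids only
through their independence oracles. Numbers can be added, subtracted and compared, but not
multiplied. -/

/-- Arithmetic expressions: literals, array cells, addition, truncated subtraction, comparison. -/
inductive NatExpr : Type
  | lit (k : ℕ)
  | get (a : ℕ) (i : NatExpr)
  | add (e f : NatExpr)
  | sub (e f : NatExpr)
  | lt (e f : NatExpr)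
  | eq (e f : NatExpr)

/-- The value of an arithmetic expression; comparisons return `1` for true and `0` for false. -/
def NatExpr.eval (m : ℕ → ℕ → ℕ) : NatExpr → ℕ
  | .lit k => k
  | .get a i => m a (i.eval m)
  | .add e f => e.eval m + f.eval m
  | .sub e f => e.eval m - f.eval m
  | .lt e f => if e.eval m < f.eval m then 1 else 0
  | .eq e f => if e.eval m = f.eval m then 1 else 0

/-- The number of elementary steps made in evaluating an arithmetic expression. -/
def NatExpr.cost : NatExpr → ℕ
  | .lit _ => 1
  | .get _ i => i.cost + 1
  | .add e f => e.cost + f.cost + 1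
  | .sub e f => e.cost + f.cost + 1
  | .lt e f => e.cost + f.cost + 1
  | .eq e f => e.cost + f.cost + 1

/-- Group expressions: the zero element, array cells, addition, negation. -/
inductive GroupExpr : Type
  | zero
  | get (a : ℕ) (i : NatExpr)
  | add (e f : GroupExpr)
  | neg (e : GroupExpr)

/-- The value of a group expression. -/
def GroupExpr.eval {Γ : Type*} [AddCommGroup Γ] (m : ℕ → ℕ → ℕ) (g : ℕ → ℕ → Γ) :
    GroupExpr → Γ
  | .zero => 0
  | .get a i => g a (i.eval m)
  | .add e f => e.eval m g + f.eval m g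
  | .neg e => -e.eval m g

/-- The number of elementary steps and group operations made in evaluating a group expression. -/
def GroupExpr.cost : GroupExpr → ℕ
  | .zero => 1
  | .get _ i => i.cost + 1
  | .add e f => e.cost + f.cost + 1
  | .neg e => e.cost + 1

/-- Programs. `setNat a i e` and `setGroup a i e` store the value of `e` in cell `i` of array `a`.
`isZero a i e` tests whether the group element `e` is zero and stores the answer in cell `i` of the
number array `a`. `indep j a i q` asks the independence oracle of the `j`-th matroid for the set
whose indicator is stored in the number array `q` and stores the answer in cell `i` of the number
array `a`. -/
inductive Program : Type
  | skip
  | setNat (a : ℕ) (i e : NatExpr)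
  | setGroup (a : ℕ) (i : NatExpr) (e : GroupExpr)
  | isZero (a : ℕ) (i : NatExpr) (e : GroupExpr)
  | indep (j : Fin 2) (a : ℕ) (i : NatExpr) (q : ℕ)
  | seq (P Q : Program)
  | cond (c : NatExpr) (P Q : Program)
  | loop (c : NatExpr) (P : Program)

/-- The memory: `nat a i` and `group a i` are the cells `i` of the number array `a` and of the group
array `a`. -/
structure Store (Γ : Type*) where
  nat : ℕ → ℕ → ℕ
  group : ℕ → ℕ → Γ

/-- The memory after writing `v` to cell `i` of the number array `a`. -/
def Store.writeNat {Γ : Type*} (s : Store Γ) (a i v : ℕ) : Store Γ :=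
  { s with nat := Function.update s.nat a (Function.update (s.nat a) i v) }

/-- The memory after writing `v` to cell `i` of the group array `a`. -/
def Store.writeGroup {Γ : Type*} (s : Store Γ) (a i : ℕ) (v : Γ) : Store Γ :=
  { s with group := Function.update s.group a (Function.update (s.group a) i v) }

/-- The subset of `{0, …, n - 1}` whose indicator is stored in the number array `a`. -/
def Store.readSet {Γ : Type*} (s : Store Γ) (n a : ℕ) : Finset (Fin n) :=
  {e : Fin n | s.nat a e ≠ 0}

open Classical in
/-- `Exec M P s s' t`: with independence oracles for the matroids `M 0` and `M 1`, the program `P`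
started on the memory `s` halts with the memory `s'` after `t` steps. Every elementary step, group
operation, zero test and oracle call counts as one step. -/
inductive Exec {n : ℕ} {Γ : Type*} [AddCommGroup Γ] (M : Fin 2 → Matroid (Fin n)) :
    Program → Store Γ → Store Γ → ℕ → Prop
  | skip (s : Store Γ) : Exec M .skip s s 1
  | setNat (s : Store Γ) (a : ℕ) (i e : NatExpr) :
      Exec M (.setNat a i e) s (s.writeNat a (i.eval s.nat) (e.eval s.nat)) (i.cost + e.cost + 1)
  | setGroup (s : Store Γ) (a : ℕ) (i : NatExpr) (e : GroupExpr) :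
      Exec M (.setGroup a i e) s (s.writeGroup a (i.eval s.nat) (e.eval s.nat s.group))
        (i.cost + e.cost + 1)
  | isZero (s : Store Γ) (a : ℕ) (i : NatExpr) (e : GroupExpr) :
      Exec M (.isZero a i e) s
        (s.writeNat a (i.eval s.nat) (if e.eval s.nat s.group = 0 then 1 else 0))
        (i.cost + e.cost + 1)
  | indep (s : Store Γ) (j : Fin 2) (a : ℕ) (i : NatExpr) (q : ℕ) :
      Exec M (.indep j a i q) s
        (s.writeNat a (i.eval s.nat)
          (if (M j).Indep (s.readSet n q : Set (Fin n)) then 1 else 0))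
        (i.cost + 1)
  | seq {P Q : Program} {s s' s'' : Store Γ} {t t' : ℕ} :
      Exec M P s s' t → Exec M Q s' s'' t' → Exec M (.seq P Q) s s'' (t + t')
  | cond_true {c : NatExpr} {P Q : Program} {s s' : Store Γ} {t : ℕ} :
      c.eval s.nat ≠ 0 → Exec M P s s' t → Exec M (.cond c P Q) s s' (c.cost + 1 + t)
  | cond_false {c : NatExpr} {P Q : Program} {s s' : Store Γ} {t : ℕ} :
      c.eval s.nat = 0 → Exec M Q s s' t → Exec M (.cond c P Q) s s' (c.cost + 1 + t)
  | loop_true {c : NatExpr} {P : Program} {s s' s'' : Store Γ} {t t' : ℕ} :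
      c.eval s.nat ≠ 0 → Exec M P s s' t → Exec M (.loop c P) s' s'' t' →
        Exec M (.loop c P) s s'' (c.cost + 1 + t + t')
  | loop_false {c : NatExpr} {P : Program} {s : Store Γ} :
      c.eval s.nat = 0 → Exec M (.loop c P) s s (c.cost + 1)

/-- The input: cell `0` of the number array `0` holds the size `n` of the ground set, and the cells
`0, …, n - 1` of the group array `0` hold the labels of its elements. -/
def inputStore {n : ℕ} {Γ : Type*} [AddCommGroup Γ] (ψ : Fin n → Γ) : Store Γ where
  nat a i := if a = 0 ∧ i = 0 then n else 0
  group a i := if h : a = 0 ∧ i < n then ψ ⟨i, h.2⟩ else 0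

/-- The final memory solves the instance: either cell `0` of the number array `1` is non-zero and
the number array `2` holds the indicator of a non-zero common basis, or that cell is zero and no
non-zero common basis exists. -/
def IsCorrectOutput {n : ℕ} {Γ : Type*} [AddCommGroup Γ] (M : Fin 2 → Matroid (Fin n))
    (ψ : Fin n → Γ) (s : Store Γ) : Prop :=
  (s.nat 1 0 ≠ 0 ∧ IsNonZeroCommonBasis (M 0) (M 1) ψ (s.readSet n 2)) ∨
    (s.nat 1 0 = 0 ∧ ¬ ∃ B : Finset (Fin n), IsNonZeroCommonBasis (M 0) (M 1) ψ B)

/-! All arcs of the exchange digraph of `B` that end in a given vertex have the same label. Hence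
the label of a walk depends only on the multiset of vertices that it enters, which is what `DWalk`
records. A closed walk that repeats a vertex splits into two closed walks, so a non-zero closed walk
exists if and only if a non-zero cycle does, and closed walks can replace cycles throughout.

Suppose that a common basis `B'` has another label than `B`. Hall's theorem gives, for each matroid,
a perfect matching of exchanges between `B' \ B` and `B \ B'`
(`Matroid.IsBase.exists_equiv_exchange`). The two matchings form a permutation of the symmetric
difference along arcs. Its orbits are cycles with total label `ψ(B') - ψ(B)`, so one of them is
non-zero. This direction works in every group.

Conversely, let `W` be inclusion-minimal among the vertex sets that carry a non-zero closed walk. A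
non-zero cycle in `W` visits all of `W`; let `L` be its label. Closed walks in `W` that miss a
vertex of `W` have label zero. Every permutation of `W` along arcs is therefore a single cycle. If
there were two of them, switching from one to the other where they differ would give a closed walk
of label `2L` that visits some vertex only once. Splitting off closed walks that miss this vertex
shows that its label is `0` or `L`. Both are impossible, the first because no element has order two.
So the permutation is unique (`perm_eq_of_label_ne_zero`). If the symmetric difference of `B` and
`W` were not a basis of one of the matroids, the matching that the cycle uses in that matroid could
be changed (`Matroid.IsBase.exists_perm_of_not_isBase`), which would give a second permutation. Thus
exchanging along `W` yields a common basis of label `ψ(B) + L`.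

For the algorithm, non-zero closed walks are detected by a Bellman–Ford scheme that keeps one label
per vertex and a mark for having seen two different ones. Greedy deletion then finds a minimal `W`.
The same improvement step also finds the initial common independent set of maximal size: add a free
element `n` and let a label in `ℤ` record whether `n` is used. A change of label at equal size then
removes `n`, that is, augments the set. Working in `Γ × ℤ`, which again has no element of order two,
handles both uses with one program. -/

/-! ### Closed walks -/

/-- `DWalk r u v s`: there is a walk from `u` to `v` along `r`, and `s` is the multiset of the
vertices that it visits after `u`. -/
inductive DWalk {V : Type*} (r : V → V → Prop) (u : V) : V → Multiset V → Prop
  | nil : DWalk r u u 0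
  | snoc {v w : V} {s : Multiset V} : DWalk r u v s → r v w → DWalk r u w (w ::ₘ s)

/-- The sum of the labels of the elements of `s`. -/
def walkLabel {V Λ : Type*} [AddCommGroup Λ] (ℓ : V → Λ) (s : Multiset V) : Λ := (s.map ℓ).sum

section Walks

variable {V Λ : Type*} [AddCommGroup Λ] {r : V → V → Prop} {ℓ : V → Λ} {u v w x y : V}
  {s t : Multiset V}

@[simp] lemma walkLabel_zero : walkLabel ℓ 0 = 0 := by simp [walkLabel]

@[simp] lemma walkLabel_cons : walkLabel ℓ (v ::ₘ s) = ℓ v + walkLabel ℓ s := by simp [walkLabel]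

@[simp] lemma walkLabel_add : walkLabel ℓ (s + t) = walkLabel ℓ s + walkLabel ℓ t := by
  simp [walkLabel]

lemma walkLabel_val (S : Finset V) : walkLabel ℓ S.val = ∑ x ∈ S, ℓ x := rfl

lemma DWalk.single (h : r u v) : DWalk r u v {v} := .snoc .nil h

lemma DWalk.trans (h₁ : DWalk r u v s) (h₂ : DWalk r v w t) : DWalk r u w (s + t) := by
  induction h₂ with
  | nil => simpa using h₁
  | snoc _ h ih => simpa using ih.snoc h

lemma DWalk.cons (h : r u v) (h₂ : DWalk r v w t) : DWalk r u w (v ::ₘ t) := by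
  simpa using (DWalk.single h).trans h₂

lemma DWalk.map {V' : Type*} {r' : V' → V' → Prop} (c : V → V')
    (hc : ∀ a b, r a b → r' (c a) (c b)) (h : DWalk r u v s) :
    DWalk r' (c u) (c v) (s.map c) := by
  induction h with
  | nil => simpa using DWalk.nil
  | snoc _ h ih => simpa using ih.snoc (hc _ _ h)

lemma DWalk.exists_rel_of_mem (h : DWalk r u v s) (hx : x ∈ s) : ∃ y, r y x := by
  induction h with
  | nil => simp at hx
  | snoc _ h ih =>
    rcases Multiset.mem_cons.1 hx with rfl | hx
    · exact ⟨_, h⟩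
    · exact ih hx

lemma DWalk.last_mem (h : DWalk r u v s) (hs : s ≠ 0) : v ∈ s := by
  cases h with
  | nil => exact absurd rfl hs
  | snoc _ _ => simp

/-- A walk can be split at a visited vertex. -/
lemma DWalk.split (h : DWalk r u v s) (hx : x ∈ s) :
    ∃ s₁ s₂, s = s₁ + s₂ ∧ DWalk r u x s₁ ∧ x ∈ s₁ ∧ DWalk r x v s₂ := by
  induction h with
  | nil => simp at hx
  | @snoc v w s hw h ih =>
    by_cases hxs : x ∈ s
    · obtain ⟨s₁, s₂, rfl, h₁, h₂, h₃⟩ := ih hxs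
      exact ⟨s₁, w ::ₘ s₂, by simp, h₁, h₂, h₃.snoc h⟩
    · obtain rfl : x = w := by simpa [hxs] using hx
      exact ⟨x ::ₘ s, 0, by simp, hw.snoc h, by simp, .nil⟩

/-- A walk that visits a vertex twice contains a closed walk. -/
lemma DWalk.exists_closed_of_not_nodup (h : DWalk r u v s) (hs : ¬ s.Nodup) :
    ∃ a s₁ s₂, s = s₁ + s₂ ∧ DWalk r a a s₁ ∧ s₁ ≠ 0 ∧ DWalk r u v s₂ ∧ s₂ ≠ 0 := by
  induction h with
  | nil => simp at hs
  | @snoc v w s hw h ih =>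
    by_cases hn : s.Nodup
    · have hws : w ∈ s := by simpa [hn] using hs
      obtain ⟨s₁, s₂, rfl, h₁, h₂, h₃⟩ := hw.split hws
      refine ⟨w, w ::ₘ s₂, s₁, by simp [add_comm], h₃.snoc h, by simp, h₁, ?_⟩
      rintro rfl
      simp at h₂
    · obtain ⟨a, s₁, s₂, rfl, h₁, h₂, h₃, h₄⟩ := ih hn
      exact ⟨a, s₁, w ::ₘ s₂, by simp, h₁, h₂, h₃.snoc h, by simp⟩

/-- There is a closed walk with non-zero label. -/
def HasNonZeroClosedWalk (r : V → V → Prop) (ℓ : V → Λ) : Prop :=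
  ∃ v s, DWalk r v v s ∧ walkLabel ℓ s ≠ 0

lemma HasNonZeroClosedWalk.mono {r' : V → V → Prop} (h : ∀ a b, r a b → r' a b)
    (H : HasNonZeroClosedWalk r ℓ) : HasNonZeroClosedWalk r' ℓ := by
  obtain ⟨v, s, hs, hl⟩ := H
  exact ⟨v, s, by simpa using hs.map id h, hl⟩

/-- A repeated vertex splits the walk into two shorter closed walks whose labels add up to the old
one, so one of them is still non-zero. -/
lemma HasNonZeroClosedWalk.exists_nodup (H : HasNonZeroClosedWalk r ℓ) :
    ∃ v s, DWalk r v v s ∧ walkLabel ℓ s ≠ 0 ∧ s.Nodup := by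
  obtain ⟨v, s, hs, hl⟩ := H
  induction hn : s.card using Nat.strong_induction_on generalizing v s with
  | _ n ih =>
    subst hn
    by_cases hd : s.Nodup
    · exact ⟨v, s, hs, hl, hd⟩
    obtain ⟨a, s₁, s₂, rfl, h₁, h₂, h₃, h₄⟩ := hs.exists_closed_of_not_nodup hd
    have c₁ := Multiset.card_pos.2 h₂
    have c₂ := Multiset.card_pos.2 h₄
    by_cases h0 : walkLabel ℓ s₁ = 0
    · exact ih _ (by simpa using c₁) v s₂ h₃ (by simpa [h0] using hl) rfl
    · exact ih _ (by simpa using c₂) a s₁ h₁ h0 rfl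

lemma DWalk.of_fun (f : ℕ → V) (k : ℕ) (h : ∀ i < k, r (f i) (f (i + 1))) :
    DWalk r (f 0) (f k) ((Multiset.range k).map fun i => f (i + 1)) := by
  induction k with
  | zero => simpa using DWalk.nil
  | succ k ih => simpa using (ih fun i hi => h i (by omega)).snoc (h k (by omega))

lemma DWalk.exists_fun (h : DWalk r u v s) :
    ∃ f : ℕ → V, f 0 = u ∧ f s.card = v ∧ (∀ i < s.card, r (f i) (f (i + 1))) ∧
      s = (Multiset.range s.card).map fun i => f (i + 1) := by
  classical
  induction h with
  | nil => exact ⟨fun _ => u, by simp⟩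
  | @snoc v w s hw h ih =>
    obtain ⟨f, h0, hk, hr, hs⟩ := ih
    refine ⟨Function.update f (s.card + 1) w, ?_, by simp, ?_, ?_⟩
    · rw [Function.update_of_ne (by omega), h0]
    · intro i hi
      rw [Multiset.card_cons] at hi
      rw [Function.update_of_ne (by omega)]
      rcases eq_or_ne i s.card with rfl | hne
      · simpa [hk] using h
      · rw [Function.update_of_ne (by omega)]
        exact hr i (by omega)
    · rw [Multiset.card_cons, Multiset.range_succ, Multiset.map_cons]
      simp only [Function.update_self]
      congr 1
      conv_lhs => rw [hs]
      refine Multiset.map_congr rfl fun i hi => ?_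
      rw [Function.update_of_ne]
      have := Multiset.mem_range.1 hi
      omega

/-- A non-empty closed walk without repeated vertices is a directed cycle. -/
lemma DWalk.exists_cycle (h : DWalk r v v s) (hs : s ≠ 0) (hd : s.Nodup) :
    ∃ (k : ℕ) (c : Fin (k + 1) → V), Function.Injective c ∧ (∀ i, r (c i) (c (i + 1))) ∧
      s = Finset.univ.val.map c := by
  obtain ⟨f, h0, hk, hr, hf⟩ := h.exists_fun
  obtain ⟨k, hc⟩ : ∃ k, s.card = k + 1 := ⟨s.card - 1, by have := Multiset.card_pos.2 hs; omega⟩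
  rw [hc] at hf hr hk
  have hmap : s = Finset.univ.val.map fun i : Fin (k + 1) => f (i.val + 1) := by
    rw [hf, Fin.univ_val_map, List.ofFn_eq_map]
    have := congrArg (fun l : List ℕ => (l.map fun i => f (i + 1) : Multiset V))
      (List.map_coe_finRange_eq_range (n := k + 1))
    simp only [List.map_map] at this
    exact this.symm
  refine ⟨k, fun i => f (i.val + 1), ?_, ?_, hmap⟩
  · rw [hmap] at hd
    intro i j hij
    exact Multiset.inj_on_of_nodup_map hd i (Finset.mem_univ_val _) j (Finset.mem_univ_val _) hij
  · intro i
    rcases eq_or_ne i (Fin.last k) with rfl | hi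
    · simpa [hk, h0] using hr 0 (by omega)
    · simp only [Fin.val_add_one_of_lt (Fin.lt_last_iff_ne_last.2 hi)]
      have : i.val < k := Fin.lt_last_iff_ne_last.2 hi
      exact hr _ (by omega)

lemma DWalk.of_cycle {k : ℕ} (c : Fin (k + 1) → V) (h : ∀ i, r (c i) (c (i + 1))) :
    DWalk r (c 0) (c 0) (Finset.univ.val.map c) := by
  have key := DWalk.of_fun (r := r) (fun i => c (Fin.ofNat (k + 1) i)) (k + 1) (fun i _ => by
    have : Fin.ofNat (k + 1) (i + 1) = Fin.ofNat (k + 1) i + 1 := by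
      ext
      simp [Fin.val_add, Fin.ofNat]
    simpa only [this] using h _)
  have e0 : Fin.ofNat (k + 1) (k + 1) = 0 := by ext; simp [Fin.ofNat]
  have e1 : Fin.ofNat (k + 1) 0 = 0 := by ext; simp [Fin.ofNat]
  simp only [e0, e1] at key
  convert key using 1
  have e2 : ((Multiset.range (k + 1)).map fun i => c (Fin.ofNat (k + 1) (i + 1))) =
      Finset.univ.val.map fun i : Fin (k + 1) => c (i + 1) := by
    rw [Fin.univ_val_map, List.ofFn_eq_map]
    have := congrArg (fun l : List ℕ => (l.map fun i => c (Fin.ofNat (k + 1) (i + 1)) : Multiset V))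
      (List.map_coe_finRange_eq_range (n := k + 1))
    simp only [List.map_map] at this
    refine this.symm.trans ?_
    congr 2
    funext i
    simp only [Function.comp]
    congr 1
    ext
    simp [Fin.val_add, Fin.ofNat]
  rw [e2]
  -- The walk enters `c 1, …, c k, c 0` in this order; as multisets, the shifted and the original
  -- enumeration agree.
  have := congrArg Finset.val (Finset.map_univ_equiv (Equiv.addRight (1 : Fin (k + 1))))
  rw [Finset.map_val] at this
  conv_lhs => rw [← this]
  rw [Multiset.map_map]
  rfl

end Walks

/-! ### Two permutations along the arcs of a digraph -/

section Perms

variable {V Λ : Type*} [Fintype V] [AddCommGroup Λ] {r : V → V → Prop} {ℓ : V → Λ}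

/-- The orbit of `x` under a permutation along arcs, as a walk from `π x` to `x`. -/
lemma exists_walk_of_perm [DecidableEq V] (π : Equiv.Perm V) (hπ : ∀ a, r a (π a)) (x : V) :
    ∃ s, DWalk r (π x) x s ∧ π x ::ₘ s = (Finset.univ.filter fun a => π.SameCycle x a).val := by
  have hper : x ∈ Function.periodicPts π := by
    refine ⟨orderOf π, orderOf_pos π, ?_⟩
    rw [Function.IsPeriodicPt, Function.IsFixedPt, ← Equiv.Perm.coe_pow, pow_orderOf_eq_one]
    rfl
  obtain ⟨n, hn⟩ : ∃ n, Function.minimalPeriod π x = n + 1 :=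
    ⟨_, (Nat.succ_pred_eq_of_pos (Function.minimalPeriod_pos_of_mem_periodicPts hper)).symm⟩
  have hx : π^[n + 1] x = x := hn ▸ Function.iterate_minimalPeriod
  -- The walk starts in `π x`, so the entered vertices begin with `π^[2] x` and end with `π^[n + 1]
  -- x = x`. For a fixed point it is empty.
  refine ⟨(Multiset.range n).map fun i => π^[i + 1 + 1] x, ?_, ?_⟩
  · have := DWalk.of_fun (r := r) (fun i => π^[i + 1] x) n (fun i _ => by
      rw [Function.iterate_succ_apply' π (i + 1)]; exact hπ _)
    simpa only [hx, zero_add, Function.iterate_one] using this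
  · have e : π x ::ₘ ((Multiset.range n).map fun i => π^[i + 1 + 1] x) =
        (Multiset.range (n + 1)).map fun i => π^[i + 1] x := by
      rw [← Multiset.coe_range, ← Multiset.coe_range, List.range_succ_eq_map]
      simp [Function.comp_def]
    rw [e]
    refine Multiset.Nodup.ext ?_ (Finset.nodup _) |>.2 ?_
    · refine Multiset.Nodup.map_on ?_ (Multiset.nodup_range _)
      intro i hi j hj hij
      rw [Multiset.mem_range, ← hn] at hi hj
      rw [Function.iterate_succ_apply', Function.iterate_succ_apply'] at hij
      exact (Function.iterate_eq_iterate_iff_of_lt_minimalPeriod hi hj).1 (π.injective hij)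
    · intro a
      simp only [Multiset.mem_map, Multiset.mem_range, Finset.mem_val, Finset.mem_filter,
        Finset.mem_univ, true_and]
      constructor
      · rintro ⟨i, -, rfl⟩
        exact ⟨(i + 1 : ℕ), by rw [zpow_natCast, Equiv.Perm.coe_pow]⟩
      · intro h
        obtain ⟨j, hj⟩ := h.exists_pow_eq' |>.imp fun _ h => h.2
        rw [Equiv.Perm.coe_pow, ← Function.iterate_mod_minimalPeriod_eq, hn] at hj
        have hlt : j % (n + 1) < n + 1 := Nat.mod_lt j (Nat.succ_pos n)
        rcases hm : j % (n + 1) with _ | m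
        · rw [hm] at hj
          exact ⟨n, by omega, by rw [hx, ← hj]; rfl⟩
        · rw [hm] at hj
          exact ⟨m, by omega, hj⟩

/-- The orbits of `π` partition the vertices, and each of them is traversed by a closed walk. -/
lemma label_eq_zero_of_orbits [DecidableEq V] (π : Equiv.Perm V) (hπ : ∀ a, r a (π a))
    (h : ∀ x s, DWalk r x x s → s = (Finset.univ.filter fun a => π.SameCycle x a).val →
      walkLabel ℓ s = 0) : ∑ x, ℓ x = 0 := by
  classical
  refine Finset.sum_cancels_of_partition_cancels (Equiv.Perm.SameCycle.setoid π) fun x _ => ?_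
  obtain ⟨s, hs, hs'⟩ := exists_walk_of_perm π hπ x
  have := h x _ (DWalk.cons (hπ x) hs) hs'
  rw [hs', walkLabel_val] at this
  rw [← this]
  refine Finset.sum_congr ?_ fun _ _ => rfl
  ext a
  simp only [Finset.mem_filter, Finset.mem_univ, true_and]
  exact Equiv.Perm.sameCycle_comm

/-- If all closed walks that avoid some vertex have label zero, then the label of a closed walk that
visits some vertex at most once is zero or the label of the vertex set. -/
lemma label_eq_zero_or_of_count_le_one [DecidableEq V]
    (hprop : ∀ v s, DWalk r v v s → (∃ u, u ∉ s) → walkLabel ℓ s = 0)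
    {v y : V} {s : Multiset V} (hs : DWalk r v v s) (hy : s.count y ≤ 1) :
    walkLabel ℓ s = 0 ∨ walkLabel ℓ s = ∑ x, ℓ x := by
  induction hn : s.card using Nat.strong_induction_on generalizing v s with
  | _ n ih =>
    subst hn
    by_cases hd : s.Nodup
    · by_cases hu : ∃ u, u ∉ s
      · exact .inl (hprop v s hs hu)
      · push Not at hu
        right
        rw [← walkLabel_val]
        congr 1
        exact (Multiset.Nodup.ext hd (Finset.nodup _)).2 (by simp [hu])
    obtain ⟨a, s₁, s₂, rfl, h₁, h₂, h₃, h₄⟩ := hs.exists_closed_of_not_nodup hd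
    have c₁ := Multiset.card_pos.2 h₂
    have c₂ := Multiset.card_pos.2 h₄
    -- At most one of the two parts visits `y`. The other one avoids `y`, so its label is zero and
    -- it can be dropped.
    rw [Multiset.count_add] at hy
    rw [walkLabel_add]
    rcases Nat.eq_zero_or_pos (s₁.count y) with h0 | h0
    · rw [hprop a s₁ h₁ ⟨y, Multiset.count_eq_zero.1 h0⟩, zero_add]
      exact ih _ (by simpa using c₁) h₃ (by omega) rfl
    · rw [hprop v s₂ h₃ ⟨y, Multiset.count_eq_zero.1 (by omega)⟩, add_zero]
      exact ih _ (by simpa using c₂) h₁ (by omega) rfl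

/-- With two or more orbits, each orbit would miss a vertex and have label zero, and so would the
whole vertex set. -/
lemma sameCycle_of_label_ne_zero [DecidableEq V]
    (hprop : ∀ v s, DWalk r v v s → (∃ u, u ∉ s) → walkLabel ℓ s = 0)
    (hL : ∑ x, ℓ x ≠ 0) (π : Equiv.Perm V) (hπ : ∀ a, r a (π a)) (x y : V) :
    π.SameCycle x y := by
  by_contra hxy
  refine hL (label_eq_zero_of_orbits (r := r) π hπ fun a s hs hs' => hprop a s hs ?_)
  subst hs'
  by_cases ha : π.SameCycle a x
  · exact ⟨y, by simpa using fun h => hxy (ha.symm.trans h)⟩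
  · exact ⟨x, by simpa using ha⟩

/-- If all closed walks that avoid some vertex have label zero, but the vertex set has non-zero
label, then at most one permutation of the vertices runs along the arcs. -/
theorem perm_eq_of_label_ne_zero [DecidableEq V] (h2 : ∀ g : Λ, g + g = 0 → g = 0)
    (hprop : ∀ v s, DWalk r v v s → (∃ u, u ∉ s) → walkLabel ℓ s = 0)
    (hL : ∑ x, ℓ x ≠ 0) (σ π : Equiv.Perm V) (hσ : ∀ a, r a (σ a)) (hπ : ∀ a, r a (π a)) :
    σ = π := by
  ext x
  by_contra hne
  obtain ⟨p, hp, hp'⟩ := exists_walk_of_perm π hπ x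
  obtain ⟨q, hq, hq'⟩ := exists_walk_of_perm σ hσ x
  have hall : ∀ ρ : Equiv.Perm V, (∀ a, r a (ρ a)) →
      (Finset.univ.filter fun a => ρ.SameCycle x a) = Finset.univ := fun ρ hρ => by
    simpa [Finset.filter_eq_self] using sameCycle_of_label_ne_zero hprop hL ρ hρ x
  rw [hall π hπ] at hp'
  rw [hall σ hσ] at hq'
  have hpn : (π x ::ₘ p).Nodup := hp' ▸ Finset.nodup _
  have hqn : (σ x ::ₘ q).Nodup := hq' ▸ Finset.nodup _
  rw [Multiset.nodup_cons] at hpn hqn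
  have hlp : ℓ (π x) + walkLabel ℓ p = ∑ x, ℓ x := by
    rw [← walkLabel_val, ← hp', walkLabel_cons]
  have hlq : ℓ (σ x) + walkLabel ℓ q = ∑ x, ℓ x := by
    rw [← walkLabel_val, ← hq', walkLabel_cons]
  have hyq : π x ∈ q := by
    have : π x ∈ σ x ::ₘ q := by rw [hq']; simp
    rcases Multiset.mem_cons.1 this with h | h
    · exact absurd h.symm hne
    · exact h
  obtain ⟨qa, qb, rfl, hqa, -, hqb⟩ := hq.split hyq
  rw [walkLabel_add] at hlq
  -- The `σ`-cycle from `π x` to `x`, closed by the arc of `π`, bypasses `σ x`.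
  have e1 : walkLabel ℓ (π x ::ₘ qb) = 0 := by
    refine hprop _ _ (hqb.snoc (hπ x)) ⟨σ x, ?_⟩
    rw [Multiset.mem_cons, not_or]
    exact ⟨hne, fun h => hqn.1 (Multiset.mem_add.2 (.inr h))⟩
  rw [walkLabel_cons] at e1
  -- The closed walk under consideration follows `π` from `π x` to `x`, and then `σ` from `x` back
  -- to `π x`. Only its last part can enter `π x`.
  have hc : (p + σ x ::ₘ qa).count (π x) ≤ 1 := by
    rw [Multiset.count_add, Multiset.count_eq_zero.2 hpn.1, zero_add,
      Multiset.count_cons_of_ne (fun h => hne h.symm)]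
    exact Multiset.nodup_iff_count_le_one.1 (Multiset.nodup_of_le (Multiset.le_add_right _ _) hqn.2) _
  have hw : DWalk r (π x) (π x) (p + σ x ::ₘ qa) := hp.trans (DWalk.cons (hσ x) hqa)
  -- The walk and the bypass of label zero together use each of the two full cycles once.
  have e2 : walkLabel ℓ (p + σ x ::ₘ qa) = ∑ x, ℓ x + ∑ x, ℓ x := by
    rw [walkLabel_add, walkLabel_cons]
    calc _ = (ℓ (π x) + walkLabel ℓ p) + (ℓ (σ x) + (walkLabel ℓ qa + walkLabel ℓ qb))
          - (ℓ (π x) + walkLabel ℓ qb) := by abel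
      _ = _ := by rw [hlp, hlq, e1, sub_zero]
  rcases label_eq_zero_or_of_count_le_one hprop hw hc with h | h
  · exact hL (h2 _ (e2.symm.trans h))
  · rw [e2] at h
    exact hL (by simpa using h)

end Perms

/-! ### Exchanges in matroids -/

section Exchange

variable {α : Type*} {M : Matroid α} {B I : Finset α}

lemma Matroid.IsBase.card_eq_of_finset (hB : M.IsBase (B : Set α)) (hI : M.IsBase (I : Set α)) :
    I.card = B.card := by
  simpa using hI.ncard_eq_ncard_of_isBase hB

lemma Matroid.Indep.isBase_of_card_eq (hB : M.IsBase (B : Set α)) (hI : M.Indep (I : Set α))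
    (h : I.card = B.card) : M.IsBase (I : Set α) := by
  obtain ⟨B', hB', hIB'⟩ := hI.exists_isBase_superset
  have hf : B'.Finite := hB.finite_of_finite B.finite_toSet hB'
  have hc : B'.ncard = B.card := by simpa using hB'.ncard_eq_ncard_of_isBase hB
  have : (I : Set α) = B' := Set.eq_of_subset_of_ncard_le hIB' (by simp [hc, h]) hf
  rwa [this]

lemma Matroid.IsBase.exchange_iff {x y : α} (hB : M.IsBase (B : Set α)) 
    (hy : y ∉ B) (hyE : y ∈ M.E) :
    M.IsBase (insert y ((B : Set α) \ {x})) ↔ y ∉ M.closure ((B : Set α) \ {x}) := by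
  have hI : M.Indep ((B : Set α) \ {x}) := hB.indep.subset Set.sdiff_subset
  have hyI : y ∉ (B : Set α) \ {x} := fun h => hy h.1
  rw [hI.notMem_closure_iff_of_notMem hyI hyE]
  exact ⟨fun h => h.indep, fun h => hB.exchange_isBase_of_indep (by simpa using hy) h⟩

variable [DecidableEq α]

/-- A self-map of a finite set permutes its periodic points, and there are some by the pigeonhole
principle. Extend this permutation by the identity; it is non-trivial because `h` has no fixed point
in `S`. -/
lemma exists_perm_of_selfMap {ι : Type*} [Finite ι] (h : ι → ι) (S : Set ι) (hS : S.Nonempty)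
    (hm : ∀ i ∈ S, h i ∈ S ∧ h i ≠ i) :
    ∃ ρ : Equiv.Perm ι, ρ ≠ 1 ∧ ∀ i, ρ i = i ∨ (i ∈ S ∧ ρ i = h i) := by
  classical
  let g : S → S := fun i => ⟨h i, (hm i i.2).1⟩
  have hbij := Function.bijOn_periodicPts (f := g)
  let e : Equiv.Perm (Function.periodicPts g) := hbij.equiv
  let ρ₁ : Equiv.Perm S := Equiv.Perm.ofSubtype e
  let ρ : Equiv.Perm ι := Equiv.Perm.ofSubtype ρ₁
  have key : ∀ i : S, i ∈ Function.periodicPts g → ρ i = h i := by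
    intro i hi
    rw [Equiv.Perm.ofSubtype_apply_coe, Equiv.Perm.ofSubtype_apply_of_mem e hi]
    rfl
  refine ⟨ρ, ?_, fun i => ?_⟩
  · obtain ⟨i₀, hi₀⟩ := hS
    obtain ⟨m, n, hmn, he⟩ := Finite.exists_ne_map_eq_of_infinite fun n : ℕ => g^[n] ⟨i₀, hi₀⟩
    obtain ⟨j, hj⟩ : ∃ j : S, j ∈ Function.periodicPts g := by
      wlog hlt : m < n generalizing m n
      · exact this n m hmn.symm he.symm (by omega)
      refine ⟨g^[m] ⟨i₀, hi₀⟩, n - m, by omega, ?_⟩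
      rw [Function.IsPeriodicPt, Function.IsFixedPt, ← Function.iterate_add_apply]
      rw [Nat.sub_add_cancel hlt.le]
      exact he.symm
    intro h1
    have := key j hj
    rw [h1] at this
    exact (hm j j.2).2 this.symm
  · by_cases hi : i ∈ S
    · by_cases hp : (⟨i, hi⟩ : S) ∈ Function.periodicPts g
      · exact .inr ⟨hi, key ⟨i, hi⟩ hp⟩
      · left
        have : ρ i = ρ₁ ⟨i, hi⟩ := Equiv.Perm.ofSubtype_apply_coe ρ₁ ⟨i, hi⟩
        rw [this, Equiv.Perm.ofSubtype_apply_of_not_mem e hp]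
    · exact .inl (Equiv.Perm.ofSubtype_apply_of_not_mem ρ₁ hi)

/-- If exchanging along a perfect matching `σ` does not lead to a basis, then there is another
perfect matching on the same vertices. -/
theorem Matroid.IsBase.exists_perm_of_not_isBase {ι : Type*} [Fintype ι] [DecidableEq ι]
    (hB : M.IsBase (B : Set α)) (c : ι → α) (hc : Function.Injective c) (σ : Equiv.Perm ι)
    (hσ : ∀ i, c i ∈ B → c (σ i) ∉ B ∧ M.IsBase (insert (c (σ i)) ((B : Set α) \ {c i})))
    (hσ' : ∀ i, c i ∉ B → c (σ i) ∈ B)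
    (hnot : ¬ M.IsBase (symmDiff B (Finset.univ.image c) : Finset α)) :
    ∃ ρ : Equiv.Perm ι, ρ ≠ 1 ∧ (∀ i, c i ∉ B → ρ i = i) ∧
      ∀ i, c i ∈ B → c (ρ i) ∈ B ∧ M.IsBase (insert (c (σ (ρ i))) ((B : Set α) \ {c i})) := by
  classical
  set W := Finset.univ.image c with hW
  have hcard : (symmDiff B W).card = B.card := by
    -- The permutation `σ` pairs the entering with the leaving elements. The exchanged set has
    -- therefore the size of a basis and can fail to be one only by being dependent.
    have h1 : (W \ B).card = (W ∩ B).card := by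
      have e1 : W \ B = (Finset.univ.filter fun i => c i ∉ B).image c := by
        ext a; simp only [hW, Finset.mem_sdiff, Finset.mem_image, Finset.mem_univ, true_and,
          Finset.mem_filter]
        constructor
        · rintro ⟨⟨i, rfl⟩, h⟩; exact ⟨i, h, rfl⟩
        · rintro ⟨i, h, rfl⟩; exact ⟨⟨i, rfl⟩, h⟩
      have e2 : W ∩ B = (Finset.univ.filter fun i => c i ∈ B).image c := by
        ext a; simp only [hW, Finset.mem_inter, Finset.mem_image, Finset.mem_univ, true_and,
          Finset.mem_filter]
        constructor
        · rintro ⟨⟨i, rfl⟩, h⟩; exact ⟨i, h, rfl⟩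
        · rintro ⟨i, h, rfl⟩; exact ⟨⟨i, rfl⟩, h⟩
      rw [e1, e2, Finset.card_image_of_injective _ hc, Finset.card_image_of_injective _ hc]
      refine Finset.card_bij (fun i _ => σ i) ?_ (fun _ _ _ _ h => σ.injective h) ?_
      · intro i hi
        simpa using hσ' i (by simpa using hi)
      · intro j hj
        refine ⟨σ.symm j, ?_, by simp⟩
        by_contra h
        have := (hσ (σ.symm j) (by simpa using h)).1
        simp only [Equiv.apply_symm_apply] at this
        exact this (by simpa using hj)
    rw [symmDiff_def, Finset.sup_eq_union, Finset.card_union_of_disjoint disjoint_sdiff_sdiff, h1,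
      Finset.inter_comm, Finset.card_sdiff_add_card_inter]
  have hnI : ¬ M.Indep (symmDiff B W : Finset α) := fun h => hnot (h.isBase_of_card_eq hB hcard)
  have hE : ∀ i, c i ∉ B → c i ∈ M.E := by
    intro i hi
    have h1 : c (σ.symm i) ∈ B := by
      by_contra h
      exact hi (by simpa using hσ' _ h)
    have := (hσ _ h1).2.subset_ground (Set.mem_insert _ _)
    simpa using this
  have hdep : M.Dep (symmDiff B W : Finset α) := by
    refine ⟨hnI, ?_⟩
    intro a ha
    rcases Finset.mem_symmDiff.1 (Finset.mem_coe.1 ha) with h | h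
    · exact hB.subset_ground h.1
    · obtain ⟨i, -, rfl⟩ := Finset.mem_image.1 h.1
      exact hE i h.2
  obtain ⟨C, hCsub, hC⟩ := hdep.exists_isCircuit_subset
  have hCcase : ∀ a ∈ C, (a ∈ B ∧ a ∉ W) ∨ ∃ i, c i = a ∧ c i ∉ B := by
    intro a ha
    rcases Finset.mem_symmDiff.1 (Finset.mem_coe.1 (hCsub ha)) with h | h
    · exact .inl h
    · obtain ⟨i, -, rfl⟩ := Finset.mem_image.1 h.1
      exact .inr ⟨i, rfl, h.2⟩
  -- `S` consists of the matching edges whose entering end lies on the circuit `C`. Each of them can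
  -- be redirected to another entering element of `C`.
  set S : Set ι := {i | c i ∈ B ∧ c (σ i) ∈ C} with hS
  have hstep : ∀ i ∈ S, ∃ j ∈ S, j ≠ i ∧
      M.IsBase (insert (c (σ j)) ((B : Set α) \ {c i})) := by
    intro i hi
    by_contra hcon
    push Not at hcon
    -- If `c i` could not be exchanged for another entering element of `C`, then the rest of `C`
    -- would be spanned by `B - c i`, and hence so would `c (σ i)`, against the exchange along `σ`.
    have hsub : C \ {c (σ i)} ⊆ M.closure ((B : Set α) \ {c i}) := by
      rintro a ⟨haC, hane⟩
      rcases hCcase a haC with ⟨haB, haW⟩ | ⟨l, rfl, hl⟩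
      · refine M.mem_closure_of_mem' ⟨haB, ?_⟩ (hB.subset_ground haB)
        rintro rfl
        exact haW (Finset.mem_image_of_mem _ (Finset.mem_univ _))
      · have hj : c (σ.symm l) ∈ B := by
          by_contra h
          exact hl (by simpa using hσ' _ h)
        have hjS : σ.symm l ∈ S := ⟨hj, by simpa using haC⟩
        have hne : σ.symm l ≠ i := by
          rintro rfl
          exact hane (by simp)
        have := hcon _ hjS hne
        rw [Equiv.apply_symm_apply, hB.exchange_iff hl (hE l hl), not_not] at this
        exact this
    have h1 : c (σ i) ∈ M.closure ((B : Set α) \ {c i}) :=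
      M.closure_subset_closure_of_subset_closure hsub
        (hC.mem_closure_sdiff_singleton_of_mem hi.2)
    obtain ⟨h2, h3⟩ := hσ i hi.1
    exact (hB.exchange_iff h2 (hE _ h2)).1 h3 h1
  choose! h hhS hhne hhB using hstep
  -- A circuit is not contained in the basis `B`, so `C` has an entering element.
  have hne : S.Nonempty := by
    by_contra hem
    rw [Set.not_nonempty_iff_eq_empty] at hem
    refine hC.not_indep ((Matroid.IsBase.indep hB).subset fun a ha => ?_)
    rcases hCcase a ha with h' | ⟨l, rfl, hl⟩
    · exact h'.1
    · exfalso
      have hj : c (σ.symm l) ∈ B := by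
        by_contra h
        exact hl (by simpa using hσ' _ h)
      have : σ.symm l ∈ S := ⟨hj, by simpa using ha⟩
      simp [hem] at this
  obtain ⟨ρ, hρ1, hρ⟩ := exists_perm_of_selfMap h S hne fun i hi => ⟨hhS i hi, hhne i hi⟩
  refine ⟨ρ, hρ1, fun i hi => (hρ i).resolve_right fun h' => hi h'.1.1, fun i hi => ?_⟩
  rcases hρ i with h' | ⟨h', h''⟩
  · rw [h']
    exact ⟨hi, (hσ i hi).2⟩
  · rw [h'']
    exact ⟨(hhS i h').1, hhB i h'⟩

/-- Two bases are joined by a perfect matching of exchanges. -/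
theorem Matroid.IsBase.exists_equiv_exchange {B' : Finset α} (hB : M.IsBase (B : Set α))
    (hB' : M.IsBase (B' : Set α)) :
    ∃ e : ↥(B' \ B) ≃ ↥(B \ B'), ∀ y : ↥(B' \ B),
      M.IsBase (insert (y : α) ((B : Set α) \ {(e y : α)})) := by
  classical
  let N : ↥(B' \ B) → Finset α := fun y =>
    (B \ B').filter fun x => M.IsBase (insert (y : α) ((B : Set α) \ {x}))
  have hall : ∀ Y : Finset ↥(B' \ B), Y.card ≤ (Y.biUnion N).card := by
    intro Y
    -- Hall's condition by comparing ranks: the fundamental circuit of `y` consists of `y`,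
    -- neighbours of `y` and elements of `B ∩ B'`. So the independent set `Y ∪ (B ∩ B')` is spanned
    -- by the neighbours of `Y` together with `B ∩ B'`.
    have hcl : ∀ y ∈ Y, (y : α) ∈ M.closure ((Y.biUnion N ∪ B ∩ B' : Finset α) : Set α) := by
      intro y hy
      obtain ⟨hyB', hyB⟩ := Finset.mem_sdiff.1 y.2
      have hycl : (y : α) ∈ M.closure (B : Set α) := by
        rw [hB.closure_eq]
        exact hB'.subset_ground hyB'
      have hC := hB.indep.fundCircuit_isCircuit hycl (by simpa using hyB)
      refine M.closure_subset_closure ?_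
        (hC.mem_closure_sdiff_singleton_of_mem (M.mem_fundCircuit _ _))
      rintro a ⟨haC, hay⟩
      have haB : a ∈ B := by
        simpa using (M.fundCircuit_subset_insert _ _ haC).resolve_left hay
      rw [Finset.coe_union]
      by_cases haB' : a ∈ B'
      · exact .inr (by simp [haB, haB'])
      · refine .inl (Finset.mem_coe.2 (Finset.mem_biUnion.2 ⟨y, hy, Finset.mem_filter.2
          ⟨Finset.mem_sdiff.2 ⟨haB, haB'⟩, ?_⟩⟩))
        have := (hB.indep.mem_fundCircuit_iff hycl (by simpa using hyB)).1 haC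
        rw [← Set.insert_sdiff_singleton_comm (fun h => hay h.symm)] at this
        exact hB.exchange_isBase_of_indep (by simpa using hyB) this
    have hYI : M.Indep ((Y.map (Function.Embedding.subtype _) ∪ B ∩ B' : Finset α) : Set α) := by
      refine hB'.indep.subset fun a ha => ?_
      rcases Finset.mem_union.1 (Finset.mem_coe.1 ha) with h | h
      · obtain ⟨y, -, rfl⟩ := Finset.mem_map.1 h
        exact (Finset.mem_sdiff.1 y.2).1
      · exact (Finset.mem_inter.1 h).2
    have hsub : ((Y.map (Function.Embedding.subtype _) ∪ B ∩ B' : Finset α) : Set α) ⊆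
        M.closure ((Y.biUnion N ∪ B ∩ B' : Finset α) : Set α) := by
      intro a ha
      rcases Finset.mem_union.1 (Finset.mem_coe.1 ha) with h | h
      · obtain ⟨y, hy, rfl⟩ := Finset.mem_map.1 h
        exact hcl y hy
      · exact M.mem_closure_of_mem' (Finset.mem_coe.2 (Finset.mem_union_right _ h))
          (hB.subset_ground (Finset.mem_inter.1 h).1)
    have hle := hYI.encard_le_eRk_of_subset hsub
    rw [Matroid.eRk_closure_eq] at hle
    replace hle := hle.trans (M.eRk_le_encard _)
    rw [Set.encard_coe_eq_coe_finsetCard, Set.encard_coe_eq_coe_finsetCard, Nat.cast_le] at hle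
    rw [Finset.card_union_of_disjoint, Finset.card_map] at hle
    · have := Finset.card_union_le (Y.biUnion N) (B ∩ B')
      omega
    · rw [Finset.disjoint_left]
      intro a ha hb
      obtain ⟨y, -, rfl⟩ := Finset.mem_map.1 ha
      exact (Finset.mem_sdiff.1 y.2).2 (Finset.mem_inter.1 hb).1
  obtain ⟨f, hf, hfN⟩ := (Finset.all_card_le_biUnion_card_iff_exists_injective N).1 hall
  have hcard : Fintype.card ↥(B' \ B) = Fintype.card ↥(B \ B') := by
    have h1 := hB.card_eq_of_finset hB'
    rw [Fintype.card_coe, Fintype.card_coe]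
    have h2 := Finset.card_sdiff_add_card_inter B' B
    have h3 := Finset.card_sdiff_add_card_inter B B'
    rw [Finset.inter_comm] at h3
    omega
  let f' : ↥(B' \ B) → ↥(B \ B') := fun y => ⟨f y, (Finset.mem_filter.1 (hfN y)).1⟩
  have hf' : Function.Bijective f' := by
    rw [Fintype.bijective_iff_injective_and_card]
    exact ⟨fun a b h => hf (congrArg Subtype.val h), hcard⟩
  exact ⟨Equiv.ofBijective f' hf', fun y => (Finset.mem_filter.1 (hfN y)).2⟩

end Exchange

/-! ### Closed walks in the exchange digraph -/

/-- The label of the arcs of the exchange digraph that end in `v`. -/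
def vertexLabel {α Λ : Type*} [DecidableEq α] [AddCommGroup Λ] (ψ : α → Λ) (B : Finset α)
    (v : α) : Λ :=
  if v ∈ B then -ψ v else ψ v

/-- The restriction of a relation to a set. -/
def restrictRel {α : Type*} (r : α → α → Prop) (W : Finset α) (u v : α) : Prop :=
  u ∈ W ∧ v ∈ W ∧ r u v

lemma restrictRel.mono {α : Type*} {r : α → α → Prop} {W W' : Finset α} (h : W ⊆ W') (u v : α)
    (huv : restrictRel r W u v) : restrictRel r W' u v :=
  ⟨h huv.1, h huv.2.1, huv.2.2⟩

section ExchangeWalks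

lemma DWalk.restrict {α : Type*} {r : α → α → Prop} {W : Finset α} {u v : α} {s : Multiset α}
    (h : DWalk r u v s) (hu : u ∈ W) (hs : ∀ x ∈ s, x ∈ W) : DWalk (restrictRel r W) u v s := by
  induction h with
  | nil => exact .nil
  | @snoc v w s hw h ih =>
    have hs' : ∀ x ∈ s, x ∈ W := fun x hx => hs x (Multiset.mem_cons_of_mem hx)
    refine (ih hs').snoc ⟨?_, hs w (Multiset.mem_cons_self _ _), h⟩
    rcases eq_or_ne s 0 with rfl | h0
    · obtain rfl : v = u := by
        generalize h0 : (0 : Multiset α) = t at hw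
        cases hw with
        | nil => rfl
        | snoc _ _ => exact absurd h0.symm (Multiset.cons_ne_zero)
      exact hu
    · exact hs' v (hw.last_mem h0)

variable {α Λ : Type*} [DecidableEq α] [AddCommGroup Λ] {ψ : α → Λ} {M₁ M₂ : Matroid α}
  {B : Finset α}

/-- This turns the label of a cycle with vertex set `W` into the change of label under the exchange
along `W`: leaving elements count negatively, entering ones positively. -/
lemma setLabel_symmDiff (ψ : α → Λ) (B W : Finset α) :
    setLabel ψ (symmDiff B W) = setLabel ψ B + ∑ x ∈ W, vertexLabel ψ B x := by
  have h1 : ∑ x ∈ W, vertexLabel ψ B x = ∑ x ∈ W \ B, ψ x - ∑ x ∈ B ∩ W, ψ x := by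
    rw [← Finset.sum_sdiff (Finset.inter_subset_left : W ∩ B ⊆ W), Finset.sdiff_inter_self_left,
      sub_eq_add_neg, ← Finset.sum_neg_distrib, Finset.inter_comm]
    congr 1
    · exact Finset.sum_congr rfl fun x hx => by simp [vertexLabel, (Finset.mem_sdiff.1 hx).2]
    · exact Finset.sum_congr rfl fun x hx => by simp [vertexLabel, (Finset.mem_inter.1 hx).1]
  have h2 : setLabel ψ B = ∑ x ∈ B \ W, ψ x + ∑ x ∈ B ∩ W, ψ x := by
    rw [setLabel, ← Finset.sum_sdiff (Finset.inter_subset_left : B ∩ W ⊆ B),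
      Finset.sdiff_inter_self_left]
  rw [h1, h2, setLabel, symmDiff_def, Finset.sup_eq_union, Finset.sum_union disjoint_sdiff_sdiff]
  abel

/-- If `W` is inclusion-minimal such that the exchange digraph has a non-zero closed walk in `W`,
then exchanging along `W` gives a common basis with a different label. -/
theorem IsCommonBasis.symmDiff_of_minimal (h2 : ∀ g : Λ, g + g = 0 → g = 0)
    (hB : IsCommonBasis M₁ M₂ B) (W : Finset α)
    (hW : HasNonZeroClosedWalk (restrictRel (exchangeDigraph M₁ M₂ B).Adj W) (vertexLabel ψ B))
    (hmin : ∀ w ∈ W, ¬ HasNonZeroClosedWalk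
      (restrictRel (exchangeDigraph M₁ M₂ B).Adj (W.erase w)) (vertexLabel ψ B)) :
    IsCommonBasis M₁ M₂ (symmDiff B W) ∧ setLabel ψ (symmDiff B W) ≠ setLabel ψ B := by
  set r := (exchangeDigraph M₁ M₂ B).Adj with hr
  set ℓ := vertexLabel ψ B with hℓ
  obtain ⟨v, s, hs, hl, hd⟩ := hW.exists_nodup
  have hs0 : s ≠ 0 := by
    rintro rfl
    simp at hl
  obtain ⟨k, c, hc, hadj, rfl⟩ := hs.exists_cycle hs0 hd
  have hcW : ∀ i, c i ∈ W := fun i => (hadj i).1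
  -- A vertex of `W` outside the cycle could be deleted from `W`, against minimality.
  have himg : W = Finset.univ.image c := by
    refine subset_antisymm (fun w hw => ?_) (fun w hw => ?_)
    · by_contra hwc
      refine hmin w hw ⟨_, _, (DWalk.of_cycle (r := r) c fun i => (hadj i).2.2).restrict ?_ ?_, hl⟩
      · refine Finset.mem_erase.2 ⟨?_, hcW _⟩
        rintro rfl
        exact hwc (Finset.mem_image_of_mem _ (Finset.mem_univ _))
      · intro x hx
        obtain ⟨i, -, rfl⟩ := Multiset.mem_map.1 hx
        refine Finset.mem_erase.2 ⟨?_, hcW _⟩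
        rintro rfl
        exact hwc (Finset.mem_image_of_mem _ (Finset.mem_univ _))
    · obtain ⟨i, -, rfl⟩ := Finset.mem_image.1 hw
      exact hcW i
  have hsum : walkLabel ℓ (Finset.univ.val.map c) = ∑ i, ℓ (c i) := by
    rw [walkLabel, Multiset.map_map]
    rfl
  have hLabel : ∑ x ∈ W, ℓ x = ∑ i, ℓ (c i) := by
    rw [himg, Finset.sum_image fun a _ b _ h => hc h]
  rw [hsum] at hl
  -- Minimality of `W`, transported to the indices of the cycle.
  have hprop : ∀ v s, DWalk (fun i j => r (c i) (c j)) v v s → (∃ u, u ∉ s) →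
      walkLabel (fun i => ℓ (c i)) s = 0 := by
    rintro v s hs ⟨u, hu⟩
    by_contra hne
    have hs0 : s ≠ 0 := by
      rintro rfl
      simp at hne
    have hmem : ∀ i ∈ s, c i ∈ W.erase (c u) := fun i hi =>
      Finset.mem_erase.2 ⟨fun h => hu (hc h ▸ hi), hcW i⟩
    refine hmin (c u) (hcW u) ⟨c v, s.map c, (hs.map c fun _ _ h => h).restrict
      (hmem v (hs.last_mem hs0)) ?_, ?_⟩
    · intro x hx
      obtain ⟨i, hi, rfl⟩ := Multiset.mem_map.1 hx
      exact hmem i hi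
    · simpa [walkLabel] using hne
  have huniq : ∀ π : Equiv.Perm (Fin (k + 1)), (∀ i, r (c i) (c (π i))) →
      π = Equiv.addRight 1 := fun π hπ =>
    perm_eq_of_label_ne_zero h2 hprop hl π (Equiv.addRight 1) hπ fun i => (hadj i).2.2
  set σ : Equiv.Perm (Fin (k + 1)) := Equiv.addRight 1 with hσ
  have hσr : ∀ i, r (c i) (c (σ i)) := fun i => (hadj i).2.2
  have hσ₁ : ∀ i, c i ∈ B → c (σ i) ∉ B ∧ M₁.IsBase (insert (c (σ i)) ((B : Set α) \ {c i})) :=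
    fun i hi => ((hσr i).resolve_right fun h => h.1 hi).2
  have hσ₂ : ∀ i, c i ∉ B → c (σ i) ∈ B ∧ M₂.IsBase (insert (c i) ((B : Set α) \ {c (σ i)})) :=
    fun i hi => ((hσr i).resolve_left fun h => hi h.1).2
  refine ⟨⟨?_, ?_⟩, ?_⟩
  · by_contra hnot
    rw [himg] at hnot
    obtain ⟨ρ, hρ1, hρ, hρB⟩ := hB.1.exists_perm_of_not_isBase c hc σ hσ₁
      (fun i hi => (hσ₂ i hi).1) hnot
    -- Since `ρ` fixes the indices of vertices outside `B`, the composition alters only arcs of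
    -- `M₁`.
    have := huniq (σ * ρ) fun i => by
      by_cases hi : c i ∈ B
      · exact .inl ⟨hi, (hσ₁ _ (hρB i hi).1).1, (hρB i hi).2⟩
      · rw [Equiv.Perm.mul_apply, hρ i hi]
        exact hσr i
    exact hρ1 (by simpa using this)
  · by_contra hnot
    rw [himg] at hnot
    -- Arcs of `M₂` run into `B`, so seen from the elements of `B` the matching is `σ⁻¹`. The
    -- altered matching is `σ⁻¹ * ρ` on `B`, and its inverse `ρ⁻¹ * σ` runs along arcs again.
    obtain ⟨ρ, hρ1, hρ, hρB⟩ := hB.2.exists_perm_of_not_isBase c hc σ⁻¹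
      (fun i hi => by
        have hn : c (σ⁻¹ i) ∉ B := fun h => (hσ₁ _ h).1 (by simpa using hi)
        exact ⟨hn, by simpa using (hσ₂ _ hn).2⟩)
      (fun i hi => by
        by_contra hn
        exact hi (by simpa using (hσ₂ _ hn).1)) hnot
    have := huniq (ρ⁻¹ * σ) fun i => by
      by_cases hi : c i ∈ B
      · have : ρ⁻¹ (σ i) = σ i := by
          rw [Equiv.Perm.inv_eq_iff_eq, hρ _ (hσ₁ i hi).1]
        rw [Equiv.Perm.mul_apply, this]
        exact hσr i
      · rw [Equiv.Perm.mul_apply]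
        have hj : ρ (ρ⁻¹ (σ i)) = σ i := by simp
        have hjB : c (ρ⁻¹ (σ i)) ∈ B := by
          by_contra hn
          have h3 := hρ _ hn
          rw [hj] at h3
          rw [← h3] at hn
          exact hn (hσ₂ i hi).1
        refine .inr ⟨hi, hjB, ?_⟩
        have := (hρB _ hjB).2
        rw [hj] at this
        simpa using this
    exact hρ1 (by simpa using this)
  · rw [setLabel_symmDiff, hLabel]
    simpa using hl

/-- If there is a common basis with a different label, then the exchange digraph has a non-zero
closed walk. -/
theorem IsCommonBasis.hasNonZeroClosedWalk (hB : IsCommonBasis M₁ M₂ B) {B' : Finset α}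
    (hB' : IsCommonBasis M₁ M₂ B') (hne : setLabel ψ B' ≠ setLabel ψ B) :
    HasNonZeroClosedWalk (restrictRel (exchangeDigraph M₁ M₂ B).Adj (symmDiff B B'))
      (vertexLabel ψ B) := by
  obtain ⟨e₁, he₁⟩ := hB.1.exists_equiv_exchange hB'.1
  obtain ⟨e₂, he₂⟩ := hB.2.exists_equiv_exchange hB'.2
  -- The permutation leaves `B' \ B` by an exchange in `M₂` and returns to it by one in `M₁`.
  let π : Equiv.Perm (↥(B' \ B) ⊕ ↥(B \ B')) :=
    (Equiv.sumCongr e₂ e₁.symm).trans (Equiv.sumComm _ _)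
  let c : ↥(B' \ B) ⊕ ↥(B \ B') → α := Sum.elim Subtype.val Subtype.val
  have hcW : ∀ a, c a ∈ symmDiff B B' := by
    rintro (a | a)
    · exact Finset.mem_symmDiff.2 (.inr (Finset.mem_sdiff.1 a.2))
    · exact Finset.mem_symmDiff.2 (.inl (Finset.mem_sdiff.1 a.2))
  by_contra hno
  have hπ : ∀ a, restrictRel (exchangeDigraph M₁ M₂ B).Adj (symmDiff B B') (c a) (c (π a)) := by
    intro a
    refine ⟨hcW _, hcW _, ?_⟩
    rcases a with a | a
    · exact .inr ⟨(Finset.mem_sdiff.1 a.2).2, (Finset.mem_sdiff.1 (e₂ a).2).1, he₂ a⟩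
    · refine .inl ⟨(Finset.mem_sdiff.1 a.2).1, (Finset.mem_sdiff.1 (e₁.symm a).2).2, ?_⟩
      have := he₁ (e₁.symm a)
      rwa [Equiv.apply_symm_apply] at this
  have h0 : ∑ a, vertexLabel ψ B (c a) = 0 := by
    refine label_eq_zero_of_orbits
      (r := fun a b => restrictRel (exchangeDigraph M₁ M₂ B).Adj (symmDiff B B') (c a) (c b))
      π hπ fun x s hs _ => ?_
    by_contra hl
    refine hno ⟨c x, s.map c, hs.map c fun _ _ h => h, ?_⟩
    simpa [walkLabel] using hl
  refine hne ?_
  have h3 : symmDiff B (symmDiff B B') = B' := by simp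
  rw [← h3, setLabel_symmDiff, add_eq_left, ← h0, Fintype.sum_sum_type]
  rw [symmDiff_def, Finset.sup_eq_union, Finset.sum_union disjoint_sdiff_sdiff, add_comm]
  congr 1 <;> exact (Finset.sum_coe_sort _ _).symm

end ExchangeWalks

/-- There is a non-zero common basis if and only if the exchange digraph of a given zero common basis
has a non-zero directed cycle. -/
theorem exists_nonZeroCommonBasis_iff {Γ : Type u} [AddCommGroup Γ] {E : Type v} [Fintype E]
    [DecidableEq E] (M₁ M₂ : Matroid E) (ψ : E → Γ) (B₀ : Finset E)
    (h2 : ∀ g : Γ, g + g = 0 → g = 0) (hB : IsCommonBasis M₁ M₂ B₀) (h0 : setLabel ψ B₀ = 0) :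
    (∃ B : Finset E, IsNonZeroCommonBasis M₁ M₂ ψ B) ↔
      ∃ (k : ℕ) (c : Fin (k + 1) → E), IsDirectedCycle (exchangeDigraph M₁ M₂ B₀) c ∧
        cycleLabel (exchangeLabel ψ B₀) c ≠ 0 := by
  have hlab : ∀ {k : ℕ} (c : Fin (k + 1) → E),
      (∀ i, (exchangeDigraph M₁ M₂ B₀).Adj (c i) (c (i + 1))) →
      cycleLabel (exchangeLabel ψ B₀) c = walkLabel (vertexLabel ψ B₀) (Finset.univ.val.map c) := by
    intro k c hc
    have h1 : walkLabel (vertexLabel ψ B₀) (Finset.univ.val.map c) =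
        ∑ i, vertexLabel ψ B₀ (c i) := by
      rw [walkLabel, Multiset.map_map]
      rfl
    -- Arcs carry the labels of their heads, hence the shift of the index by one.
    rw [h1, cycleLabel, ← Equiv.sum_comp (Equiv.addRight (1 : Fin (k + 1))) fun i => vertexLabel ψ B₀ (c i)]
    refine Finset.sum_congr rfl fun i _ => ?_
    rcases hc i with ⟨h3, h4, -⟩ | ⟨h3, h4, -⟩ <;> simp [exchangeLabel, vertexLabel, h3, h4]
  constructor
  · rintro ⟨B, hB', hne⟩
    obtain ⟨v, s, hs, hl, hd⟩ :=
      (hB.hasNonZeroClosedWalk (ψ := ψ) hB' (by rwa [h0])).exists_nodup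
    have hs0 : s ≠ 0 := by
      rintro rfl
      simp at hl
    obtain ⟨k, c, hc, hadj, rfl⟩ := hs.exists_cycle hs0 hd
    exact ⟨k, c, ⟨hc, fun i => (hadj i).2.2⟩, by rwa [hlab c fun i => (hadj i).2.2]⟩
  · rintro ⟨k, c, ⟨-, hadj⟩, hl⟩
    rw [hlab c hadj] at hl
    classical
    let P : Finset E → Prop := fun W => HasNonZeroClosedWalk
      (restrictRel (exchangeDigraph M₁ M₂ B₀).Adj W) (vertexLabel ψ B₀)
    have hP : P Finset.univ := ⟨_, _, (DWalk.of_cycle c hadj).restrict (by simp) (by simp), hl⟩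
    obtain ⟨W, -, hW⟩ := exists_minimal_le_of_wellFoundedLT P _ hP
    have := hB.symmDiff_of_minimal h2 W hW.prop fun w hw h =>
      (Finset.erase_ssubset hw).not_subset (hW.le_of_le h (Finset.erase_subset _ _))
    exact ⟨_, this.1, by rw [← h0]; exact this.2⟩

/-! ### Reasoning about programs -/

section Semantics

variable {n : ℕ} {Γ : Type*} [AddCommGroup Γ] {M : Fin 2 → Matroid (Fin n)} {P Q : Program}
  {s s' : Store Γ} {T T' : ℕ} {A A' : Store Γ → Prop}

/-- The program `P` started on `s` halts after at most `T` steps on a memory that satisfies `A`. -/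
def Runs (M : Fin 2 → Matroid (Fin n)) (P : Program) (s : Store Γ) (T : ℕ)
    (A : Store Γ → Prop) : Prop :=
  ∃ s' t, Exec M P s s' t ∧ t ≤ T ∧ A s'

lemma Runs.mono (h : Runs M P s T A) (hT : T ≤ T') (hA : ∀ s', A s' → A' s') :
    Runs M P s T' A' := by
  obtain ⟨s', t, he, ht, ha⟩ := h
  exact ⟨s', t, he, ht.trans hT, hA _ ha⟩

lemma Runs.seq (h : Runs M P s T A) (h' : ∀ s', A s' → Runs M Q s' T' A') :
    Runs M (.seq P Q) s (T + T') A' := by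
  obtain ⟨s', t, he, ht, ha⟩ := h
  obtain ⟨s'', t', he', ht', ha'⟩ := h' s' ha
  exact ⟨s'', t + t', he.seq he', by omega, ha'⟩

lemma Runs.cond {c : NatExpr} (h : c.eval s.nat ≠ 0 → Runs M P s T A)
    (h' : c.eval s.nat = 0 → Runs M Q s T A) : Runs M (.cond c P Q) s (c.cost + 1 + T) A := by
  by_cases hc : c.eval s.nat = 0
  · obtain ⟨s', t, he, ht, ha⟩ := h' hc
    exact ⟨s', _, .cond_false hc he, by omega, ha⟩
  · obtain ⟨s', t, he, ht, ha⟩ := h hc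
    exact ⟨s', _, .cond_true hc he, by omega, ha⟩

/-- Whether `P` contains no loop. -/
def Program.loopFree : Program → Bool
  | .seq P Q => P.loopFree && Q.loopFree
  | .cond _ P Q => P.loopFree && Q.loopFree
  | .loop _ _ => false
  | _ => true

/-- A bound for the running time of a program without loops. -/
def Program.maxCost : Program → ℕ
  | .skip => 1
  | .setNat _ i e => i.cost + e.cost + 1
  | .setGroup _ i e => i.cost + e.cost + 1
  | .isZero _ i e => i.cost + e.cost + 1
  | .indep _ _ i _ => i.cost + 1
  | .seq P Q => P.maxCost + Q.maxCost
  | .cond c P Q => c.cost + 1 + max P.maxCost Q.maxCost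
  | .loop _ _ => 0

open Classical in
/-- The effect of a program without loops. -/
noncomputable def Program.eff (M : Fin 2 → Matroid (Fin n)) : Program → Store Γ → Store Γ
  | .skip, s => s
  | .setNat a i e, s => s.writeNat a (i.eval s.nat) (e.eval s.nat)
  | .setGroup a i e, s => s.writeGroup a (i.eval s.nat) (e.eval s.nat s.group)
  | .isZero a i e, s =>
      s.writeNat a (i.eval s.nat) (if e.eval s.nat s.group = 0 then 1 else 0)
  | .indep j a i q, s =>
      s.writeNat a (i.eval s.nat) (if (M j).Indep (s.readSet n q : Set (Fin n)) then 1 else 0)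
  | .seq P Q, s => Q.eff M (P.eff M s)
  | .cond c P Q, s => if c.eval s.nat = 0 then Q.eff M s else P.eff M s
  | .loop _ _, s => s

/-- This reduces the verification of loop-free pieces to a computation: `eff` is evaluated by `simp`
and the bound `maxCost` by `decide`. -/
lemma Program.exec_eff (hP : P.loopFree) (s : Store Γ) :
    ∃ t ≤ P.maxCost, Exec M P s (P.eff M s) t := by
  induction P generalizing s with
  | skip => exact ⟨_, le_rfl, .skip s⟩
  | setNat a i e => exact ⟨_, le_rfl, .setNat s a i e⟩
  | setGroup a i e => exact ⟨_, le_rfl, .setGroup s a i e⟩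
  | isZero a i e => exact ⟨_, le_rfl, .isZero s a i e⟩
  | indep j a i q => exact ⟨_, le_rfl, .indep s j a i q⟩
  | seq P Q ihP ihQ =>
    simp only [loopFree, Bool.and_eq_true] at hP
    obtain ⟨t, ht, h⟩ := ihP hP.1 s
    obtain ⟨t', ht', h'⟩ := ihQ hP.2 (P.eff M s)
    exact ⟨t + t', add_le_add ht ht', h.seq h'⟩
  | cond c P Q ihP ihQ =>
    simp only [loopFree, Bool.and_eq_true] at hP
    simp only [eff, maxCost]
    split_ifs with hc
    · obtain ⟨t, ht, h⟩ := ihQ hP.2 s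
      exact ⟨_, by have := le_max_right P.maxCost Q.maxCost; omega, .cond_false hc h⟩
    · obtain ⟨t, ht, h⟩ := ihP hP.1 s
      exact ⟨_, by have := le_max_left P.maxCost Q.maxCost; omega, .cond_true hc h⟩
  | loop c P => simp [loopFree] at hP

lemma Runs.of_loopFree (hP : P.loopFree) (hT : P.maxCost ≤ T) (hA : A (P.eff M s)) :
    Runs M P s T A := by
  obtain ⟨t, ht, h⟩ := Program.exec_eff (M := M) hP s
  exact ⟨_, t, h, ht.trans hT, hA⟩

/-- Whether `P` contains an instruction that writes to the number array `a`. -/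
def Program.writesNat (a : ℕ) : Program → Bool
  | .setNat a' _ _ => a' == a
  | .isZero a' _ _ => a' == a
  | .indep _ a' _ _ => a' == a
  | .seq P Q => P.writesNat a || Q.writesNat a
  | .cond _ P Q => P.writesNat a || Q.writesNat a
  | .loop _ P => P.writesNat a
  | _ => false

/-- Whether `P` contains an instruction that writes to the group array `a`. -/
def Program.writesGroup (a : ℕ) : Program → Bool
  | .setGroup a' _ _ => a' == a
  | .seq P Q => P.writesGroup a || Q.writesGroup a
  | .cond _ P Q => P.writesGroup a || Q.writesGroup a
  | .loop _ P => P.writesGroup a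
  | _ => false

/-- The memories agree in the arrays that `P` does not write to. -/
def Agree (P : Program) (s s' : Store Γ) : Prop :=
  (∀ a, P.writesNat a = false → s'.nat a = s.nat a) ∧
    ∀ a, P.writesGroup a = false → s'.group a = s.group a

omit [AddCommGroup Γ] in
lemma Agree.refl (s : Store Γ) : Agree P s s := ⟨fun _ _ => rfl, fun _ _ => rfl⟩

omit [AddCommGroup Γ] in
lemma Agree.trans {s'' : Store Γ} (h : Agree P s s') (h' : Agree P s' s'') : Agree P s s'' :=
  ⟨fun a ha => (h'.1 a ha).trans (h.1 a ha), fun a ha => (h'.2 a ha).trans (h.2 a ha)⟩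

omit [AddCommGroup Γ] in
lemma Agree.of_writeNat {a i v : ℕ} (ha : P.writesNat a = true) :
    Agree P s (s.writeNat a i v) := by
  refine ⟨fun a' ha' => ?_, fun _ _ => rfl⟩
  have : a' ≠ a := by
    rintro rfl
    simp [ha] at ha'
  simp [Store.writeNat, this]

omit [AddCommGroup Γ] in
lemma Agree.of_writeGroup {a i : ℕ} {v : Γ} (ha : P.writesGroup a = true) :
    Agree P s (s.writeGroup a i v) := by
  refine ⟨fun _ _ => rfl, fun a' ha' => ?_⟩
  have : a' ≠ a := by
    rintro rfl
    simp [ha] at ha'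
  simp [Store.writeGroup, this]

omit [AddCommGroup Γ] in
lemma Agree.mono (h : Agree P s s') (hn : ∀ a, Q.writesNat a = false → P.writesNat a = false)
    (hg : ∀ a, Q.writesGroup a = false → P.writesGroup a = false) : Agree Q s s' :=
  ⟨fun a ha => h.1 a (hn a ha), fun a ha => h.2 a (hg a ha)⟩

/-- The frame rule. Which arrays a program can touch is read off its text, so that a fixed array is
untouched can be checked by `rfl`. -/
lemma Exec.agree {t : ℕ} (h : Exec M P s s' t) : Agree P s s' := by
  induction h with
  | skip s => exact .refl _
  | setNat => exact .of_writeNat (by simp [Program.writesNat])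
  | setGroup => exact .of_writeGroup (by simp [Program.writesGroup])
  | isZero => exact .of_writeNat (by simp [Program.writesNat])
  | indep => exact .of_writeNat (by simp [Program.writesNat])
  | seq _ _ ih ih' =>
    exact (ih.mono (by simp +contextual [Program.writesNat])
      (by simp +contextual [Program.writesGroup])).trans (ih'.mono
      (by simp +contextual [Program.writesNat]) (by simp +contextual [Program.writesGroup]))
  | cond_true _ _ ih =>
    exact ih.mono (by simp +contextual [Program.writesNat])
      (by simp +contextual [Program.writesGroup])
  | cond_false _ _ ih =>
    exact ih.mono (by simp +contextual [Program.writesNat])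
      (by simp +contextual [Program.writesGroup])
  | loop_true _ _ _ ih ih' =>
    exact (ih.mono (by simp [Program.writesNat]) (by simp [Program.writesGroup])).trans ih'
  | loop_false => exact .refl _

lemma Runs.agree (h : Runs M P s T A) : Runs M P s T fun s' => A s' ∧ Agree P s s' := by
  obtain ⟨s', t, he, ht, ha⟩ := h
  exact ⟨s', t, he, ht, ha, he.agree⟩

/-- The value of cell `0` of the number array `a`. -/
abbrev NatExpr.var (a : ℕ) : NatExpr := .get a (.lit 0)

/-- Run `P` with the counter `i` from `0` up to the value of `b`. -/
def forLoop (i b : ℕ) (P : Program) : Program :=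
  .seq (.setNat i (.lit 0) (.lit 0))
    (.loop (.lt (.var i) (.var b)) (.seq P (.setNat i (.lit 0) (.add (.var i) (.lit 1)))))

/-- Per round, the test of the condition takes 6 steps and the increment takes 6. The 9 extra steps
are 3 for the initialization and 6 for the final test. The invariant must survive writes to a
counter cell, because the counter changes between rounds; `stable` provides this. -/
lemma Runs.forLoop {i b : ℕ} (N : ℕ) (Inv : ℕ → Store Γ → Prop) (hN : s.nat b 0 = N)
    (hb : (forLoop i b P).writesNat b = false) (hi : P.writesNat i = false)
    (stable : ∀ k s v, Inv k s → Inv k (s.writeNat i 0 v)) (h0 : Inv 0 s)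
    (step : ∀ k < N, ∀ s', s'.nat i 0 = k → Agree (forLoop i b P) s s' → Inv k s' →
      Runs M P s' T (Inv (k + 1))) :
    Runs M (forLoop i b P) s (N * (T + 12) + 9) (Inv N) := by
  have hwi : (_root_.forLoop i b P).writesNat i = true := by simp [_root_.forLoop, Program.writesNat]
  have key : ∀ d k s', k + d = N → s'.nat i 0 = k → Agree (_root_.forLoop i b P) s s' → Inv k s' →
      Runs M (.loop (.lt (.var i) (.var b)) (.seq P (.setNat i (.lit 0) (.add (.var i) (.lit 1)))))
        s' (d * (T + 12) + 6) (Inv N) := by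
    intro d
    induction d with
    | zero =>
      intro k s' hk hik hag hinv
      obtain rfl : k = N := by omega
      refine ⟨s', _, .loop_false ?_, ?_, hinv⟩
      · simp [NatExpr.eval, hik, hag.1 b hb, hN]
      · simp [NatExpr.cost]
    | succ d ih =>
      intro k s' hk hik hag hinv
      obtain ⟨s₁, t₁, he₁, ht₁, hA₁⟩ := step k (by omega) s' hik hag hinv
      have hik₁ : s₁.nat i 0 = k := by rw [he₁.agree.1 i hi, hik]
      have hag₁ : Agree (_root_.forLoop i b P) s' s₁ := he₁.agree.mono
        (by simp +contextual [_root_.forLoop, Program.writesNat])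
        (by simp +contextual [_root_.forLoop, Program.writesGroup])
      obtain ⟨s₂, t₂, he₂, ht₂, hA₂⟩ := ih (k + 1) (s₁.writeNat i 0 (k + 1)) (by omega)
        (by simp [Store.writeNat]) ((hag.trans hag₁).trans (.of_writeNat hwi))
        (stable _ _ _ hA₁)
      have he := Exec.setNat (M := M) s₁ i (.lit 0) (.add (.var i) (.lit 1))
      simp only [NatExpr.eval, NatExpr.cost, hik₁] at he
      refine ⟨s₂, _, .loop_true ?_ (he₁.seq he) he₂, ?_, hA₂⟩
      · have : k < N := by omega
        simp [NatExpr.eval, hik, hag.1 b hb, hN, this]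
      · simp only [NatExpr.cost]
        rw [Nat.succ_mul]
        omega
  have he := Exec.setNat (M := M) s i (.lit 0) (.lit 0)
  simp only [NatExpr.eval, NatExpr.cost] at he
  obtain ⟨s₂, t₂, he₂, ht₂, hA₂⟩ := key N 0 (s.writeNat i 0 0) (by omega)
    (by simp [Store.writeNat]) (.of_writeNat hwi) (stable _ _ _ h0)
  exact ⟨s₂, _, he.seq he₂, by omega, hA₂⟩

end Semantics

/-! ### Relaxation of arcs -/

section Relax

variable {Λ : Type*} [AddCommGroup Λ]

open Classical in
/-- One relaxation of the pair `u`, `v`. The first component counts, up to two, the labels that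
were found for walks to a vertex, and the second component is such a label. -/
noncomputable def relax (A : ℕ → ℕ → Prop) (ℓ : ℕ → Λ) (u v : ℕ) (p : (ℕ → ℕ) × (ℕ → Λ)) :
    (ℕ → ℕ) × (ℕ → Λ) :=
  if A u v ∧ p.1 u ≠ 0 then
    if p.1 v = 0 then (Function.update p.1 v (p.1 u), Function.update p.2 v (p.2 u + ℓ v))
    else if p.1 u = 1 ∧ p.2 u + ℓ v = p.2 v then p else (Function.update p.1 v 2, p.2)
  else p

/-- The label `a` was found for a walk to `v`, or two other labels were. -/
def Covers (p : (ℕ → ℕ) × (ℕ → Λ)) (v : ℕ) (a : Λ) : Prop :=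
  p.1 v = 2 ∨ (p.1 v = 1 ∧ p.2 v = a)

/-- All labels that were found below `N` are labels of walks from `x`. -/
def SoundLabels (A : ℕ → ℕ → Prop) (ℓ : ℕ → Λ) (N x : ℕ) (p : (ℕ → ℕ) × (ℕ → Λ)) : Prop :=
  ∀ v < N, p.1 v ≤ 2 ∧ (p.1 v = 1 → ∃ m, DWalk A x v m ∧ walkLabel ℓ m = p.2 v) ∧
    (p.1 v = 2 → ∃ m m', DWalk A x v m ∧ DWalk A x v m' ∧ walkLabel ℓ m ≠ walkLabel ℓ m')

variable {A : ℕ → ℕ → Prop} {ℓ : ℕ → Λ} {N x u v w k i j : ℕ} {p : (ℕ → ℕ) × (ℕ → Λ)} {a : Λ}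

lemma Covers.relax (h : Covers p w a) : Covers (relax A ℓ u v p) w a := by
  unfold _root_.relax
  split_ifs with h1 h2 h3
  · rcases eq_or_ne w v with rfl | hw
    · rcases h with h | ⟨h, -⟩ <;> omega
    · simpa [Covers, hw] using h
  · exact h
  · rcases eq_or_ne w v with rfl | hw
    · simp [Covers]
    · simpa [Covers, hw] using h
  · exact h

/-- A vertex with count two counts as covering every label. This is consistent because a count of
two is passed on along arcs. Soundness serves only to bound the count of `v` by two. -/
lemma Covers.relax_arc (hN : ∀ u v, A u v → u < N ∧ v < N) (hs : SoundLabels A ℓ N x p) (hA : A u v) (h : Covers p u a) :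
    Covers (_root_.relax A ℓ u v p) v (a + ℓ v) := by
  have hu : p.1 u ≠ 0 := by rcases h with h | ⟨h, -⟩ <;> omega
  unfold _root_.relax
  rw [if_pos ⟨hA, hu⟩]
  split_ifs with h2 h3
  · rcases h with h | ⟨h, h'⟩
    · exact .inl (by simpa using h)
    · exact .inr (by simp [h, h'])
  · rcases h with h | ⟨h, h'⟩
    · omega
    · have := (hs v (hN u v hA).2).1
      rcases Nat.lt_or_ge (p.1 v) 2 with h4 | h4
      · exact .inr ⟨by omega, by rw [← h', h3.2]⟩
      · exact .inl (by omega)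
  · exact .inl (by simp)

/-- A count rises to two for one of two reasons: the tail has two walks of different labels, which
stay different when extended by the arc, or the label arriving from the tail differs from the one
stored at the head. -/
lemma SoundLabels.relax (hN : ∀ u v, A u v → u < N ∧ v < N) (hs : SoundLabels A ℓ N x p) : SoundLabels A ℓ N x (relax A ℓ u v p) := by
  unfold _root_.relax
  split_ifs with h1 h2 h3
  · intro w hw'
    obtain ⟨hu, hv⟩ := hN u v h1.1
    rcases eq_or_ne w v with rfl | hw
    · simp only [Function.update_self]
      refine ⟨(hs u hu).1, fun h => ?_, fun h => ?_⟩
      · obtain ⟨m, hm, hl⟩ := (hs u hu).2.1 h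
        exact ⟨_, hm.snoc h1.1, by rw [walkLabel_cons, hl, add_comm]⟩
      · obtain ⟨m, m', hm, hm', hl⟩ := (hs u hu).2.2 h
        exact ⟨_, _, hm.snoc h1.1, hm'.snoc h1.1, by simpa using hl⟩
    · simpa [hw] using hs w hw'
  · exact hs
  · intro w hw'
    obtain ⟨hu, hv⟩ := hN u v h1.1
    rcases eq_or_ne w v with rfl | hw
    · simp only [Function.update_self]
      refine ⟨le_rfl, by simp, fun _ => ?_⟩
      have h4 : p.1 u = 1 ∨ p.1 u = 2 := by have := (hs u hu).1; omega
      have h5 : p.1 w = 1 ∨ p.1 w = 2 := by have := (hs w hw').1; omega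
      rcases h5 with h5 | h5
      swap
      · exact (hs w hw').2.2 h5
      rcases h4 with h4 | h4
      · obtain ⟨m, hm, hl⟩ := (hs u hu).2.1 h4
        obtain ⟨m', hm', hl'⟩ := (hs w hw').2.1 h5
        refine ⟨_, _, hm.snoc h1.1, hm', ?_⟩
        rw [walkLabel_cons, hl, hl', add_comm]
        exact fun h => h3 ⟨h4, h⟩
      · obtain ⟨m, m', hm, hm', hl⟩ := (hs u hu).2.2 h4
        exact ⟨_, _, hm.snoc h1.1, hm'.snoc h1.1, by simpa using hl⟩
    · simpa [hw] using hs w hw'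
  · exact hs

/-- The labels of all walks of length at most `k` were found, and moreover those of their
extensions by an arc `u v` with `(u, v)` lexicographically smaller than `(i, j)`. -/
def Progress (A : ℕ → ℕ → Prop) (ℓ : ℕ → Λ) (N x k i j : ℕ) (p : (ℕ → ℕ) × (ℕ → Λ)) : Prop :=
  SoundLabels A ℓ N x p ∧
    (∀ v m, DWalk A x v m → m.card ≤ k → Covers p v (walkLabel ℓ m)) ∧
    ∀ u v m, DWalk A x u m → m.card ≤ k → A u v → u < i ∨ (u = i ∧ v < j) →
      Covers p v (walkLabel ℓ m + ℓ v)

lemma Progress.relax (hN : ∀ u v, A u v → u < N ∧ v < N) (h : Progress A ℓ N x k i j p) :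
    Progress A ℓ N x k i (j + 1) (relax A ℓ i j p) := by
  refine ⟨h.1.relax hN, fun v m hm hk => (h.2.1 v m hm hk).relax, fun u v m hm hk hA hlt => ?_⟩
  by_cases hv : u < i ∨ (u = i ∧ v < j)
  · exact (h.2.2 u v m hm hk hA hv).relax
  · obtain ⟨rfl, rfl⟩ : u = i ∧ v = j := by omega
    exact (h.2.1 u m hm hk).relax_arc hN h.1 hA

lemma Progress.next_tail (hN : ∀ u v, A u v → u < N ∧ v < N)
    (h : Progress A ℓ N x k i N p) : Progress A ℓ N x k (i + 1) 0 p :=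
  ⟨h.1, h.2.1, fun u v m hm hk hA hlt => h.2.2 u v m hm hk hA (by have := hN u v hA; omega)⟩

/-- A walk of length at most `k + 1` is empty or extends one of length at most `k` by an arc, and
all arcs have been relaxed. -/
lemma Progress.next_length (hN : ∀ u v, A u v → u < N ∧ v < N)
    (h : Progress A ℓ N x k N 0 p) : Progress A ℓ N x (k + 1) 0 0 p := by
  refine ⟨h.1, fun v m hm hk => ?_, fun u v m hm hk hA hlt => by omega⟩
  cases hm with
  | nil => exact h.2.1 _ _ .nil (by simp)
  | snoc hm hA =>
    rw [walkLabel_cons, add_comm]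
    exact h.2.2 _ _ _ hm (by simpa using hk) hA (.inl (hN _ _ hA).1)

lemma Progress.init (hx : x < N) (h1 : ∀ v < N, p.1 v = if v = x then 1 else 0) (h2 : p.2 x = 0) :
    Progress A ℓ N x 0 0 0 p := by
  refine ⟨fun v hv => ?_, fun v m hm hk => ?_, fun u v m hm hk hA hlt => by omega⟩
  · rw [h1 v hv]
    split_ifs with h
    · subst h
      exact ⟨by omega, fun _ => ⟨0, .nil, by simp [h2]⟩, by simp⟩
    · simp
  · obtain rfl : m = 0 := by simpa using hk
    generalize h0 : (0 : Multiset ℕ) = t at hm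
    cases hm with
    | nil => exact .inr ⟨by simp [h1 _ hx], by simp [h2]⟩
    | snoc _ _ => exact absurd h0.symm Multiset.cons_ne_zero

/-- The empty walk has label zero, so a single stored label at `x` cannot also account for `m`. -/
lemma Progress.eq_two (h : Progress A ℓ N x k 0 0 p) {m : Multiset ℕ} (hm : DWalk A x x m)
    (hk : m.card ≤ k) (hl : walkLabel ℓ m ≠ 0) : p.1 x = 2 := by
  rcases h.2.1 x m hm hk with h1 | ⟨h1, h2⟩
  · exact h1
  · rcases h.2.1 x 0 .nil (by simp) with h3 | ⟨-, h4⟩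
    · exact h3
    · rw [h4, walkLabel_zero] at h2
      exact absurd h2.symm hl

/-- Of two closed walks with different labels, at least one is non-zero. The length of these walks
is irrelevant. -/
lemma Progress.hasNonZeroClosedWalk (hx : x < N) (h : Progress A ℓ N x k i j p) (h2 : p.1 x = 2) :
    HasNonZeroClosedWalk A ℓ := by
  obtain ⟨m, m', hm, hm', hl⟩ := (h.1 x hx).2.2 h2
  by_cases h0 : walkLabel ℓ m = 0
  · exact ⟨x, m', hm', fun h => hl (h0.trans h.symm)⟩
  · exact ⟨x, m, hm, h0⟩

end Relax

/-! ### The program for non-zero closed walks -/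

/-- Compute in the number array `13` whether the exchange digraph has an arc from `var 9` to
`var 10`. The array `2` holds the current set. -/
def adjProgram : Program :=
  .cond (.eq (.get 2 (.var 9)) (.get 2 (.var 10))) (.setNat 13 (.lit 0) (.lit 0))
    (.seq (.setNat 2 (.var 9) (.sub (.lit 1) (.get 2 (.var 9))))
    (.seq (.setNat 2 (.var 10) (.sub (.lit 1) (.get 2 (.var 10))))
    (.seq (.cond (.get 2 (.var 10)) (.indep 0 13 (.lit 0) 2) (.indep 1 13 (.lit 0) 2))
    (.seq (.setNat 2 (.var 9) (.sub (.lit 1) (.get 2 (.var 9))))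
      (.setNat 2 (.var 10) (.sub (.lit 1) (.get 2 (.var 10))))))))

/-- Store the label of the arcs that end in `var 10` in the group array `4`. -/
def arcLabelProgram : Program :=
  .cond (.get 2 (.var 10)) (.setGroup 4 (.lit 0) (.neg (.get 1 (.var 10))))
    (.setGroup 4 (.lit 0) (.get 1 (.var 10)))

/-- Relax the arc from `var 9` to `var 10`. -/
def updateProgram : Program :=
  .cond (.get 5 (.var 9))
    (.cond (.eq (.get 5 (.var 10)) (.lit 0))
      (.seq (.setGroup 2 (.var 10) (.add (.get 2 (.var 9)) (.get 4 (.lit 0))))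
      (.seq (.setNat 6 (.var 10) (.add (.get 6 (.var 9)) (.eq (.var 10) (.var 0))))
        (.setNat 5 (.var 10) (.get 5 (.var 9)))))
      (.seq (.isZero 16 (.lit 0)
        (.add (.add (.get 2 (.var 9)) (.get 4 (.lit 0))) (.neg (.get 2 (.var 10)))))
      -- A conjunction of three tests, written as a sum of indicators that exceeds two: the tail has
      -- a single label, and the arriving label agrees with the stored one in the `Γ`-part and in
      -- the integer part.
      (.cond (.lt (.lit 2) (.add (.add (.eq (.get 5 (.var 9)) (.lit 1)) (.var 16))
          (.eq (.add (.get 6 (.var 9)) (.eq (.var 10) (.var 0))) (.get 6 (.var 10)))))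
        .skip (.setNat 5 (.var 10) (.lit 2)))))
    .skip

/-- Relax the arc from `var 9` to `var 10` if it is present and both ends belong to the set that is
stored in the array `4`. -/
def relaxProgram : Program :=
  .seq adjProgram (.cond (.var 13) (.cond (.get 4 (.var 9)) (.cond (.get 4 (.var 10))
    (.seq arcLabelProgram updateProgram) .skip) .skip) .skip)

/-- The set of the numbers below `N` at which `b` is not zero. -/
def supportBelow (N : ℕ) (b : ℕ → ℕ) : Finset ℕ := (Finset.range N).filter fun i => b i ≠ 0

/-- The adjacency that `adjProgram` computes. -/
def OracleAdj {n : ℕ} (M : Fin 2 → Matroid (Fin n)) (b : ℕ → ℕ) (u v : ℕ) : Prop :=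
  b u ≠ b v ∧ (M (if b u = 0 then 1 else 0)).Indep
    {e : Fin n | Function.update (Function.update b u (1 - b u)) v (1 - b v) e ≠ 0}

/-- The labels of the arcs with given ends. The second component counts visits of `n`. -/
def oracleLabel {Γ : Type*} [AddCommGroup Γ] (n : ℕ) (b : ℕ → ℕ) (L : ℕ → Γ) (v : ℕ) : Γ × ℤ :=
  (if b v = 0 then L v else -L v, if v = n then 1 else 0)

/-- The labels stored in a memory. -/
def Store.labels {Γ : Type*} (s : Store Γ) : (ℕ → ℕ) × (ℕ → Γ × ℤ) :=
  (s.nat 5, fun v => (s.group 2 v, (s.nat 6 v : ℤ)))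

section Programs

variable {n : ℕ} {Γ : Type*} [AddCommGroup Γ] {M : Fin 2 → Matroid (Fin n)} {s : Store Γ}
  {b : ℕ → ℕ} {N : ℕ}

open Classical in
lemma runs_adjProgram (hb : ∀ i, s.nat 2 i ≤ 1) : Runs M adjProgram s 100 fun s' =>
    s'.nat 2 = s.nat 2 ∧
      s'.nat 13 0 = if OracleAdj M (s.nat 2) (s.nat 9 0) (s.nat 10 0) then 1 else 0 := by
  refine Runs.of_loopFree rfl (by decide) ?_
  set u := s.nat 9 0 with hu
  set v := s.nat 10 0 with hv
  by_cases huv : s.nat 2 u = s.nat 2 v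
  · have hno : ¬ OracleAdj M (s.nat 2) u v := fun h => h.1 huv
    simp [adjProgram, Program.eff, NatExpr.eval, Store.writeNat, ← hu, ← hv, huv, hno]
  · have hne : u ≠ v := fun h => huv (by rw [h])
    have h1 := hb u
    have h2 := hb v
    -- Toggling both ends twice restores the array, because the ends are distinct and the entries
    -- are `0` or `1`.
    have hup : ∀ {x y : ℕ}, s.nat 2 u = x → s.nat 2 v = y → Function.update (Function.update
        (Function.update (Function.update (s.nat 2) u y) v x) u x) v y = s.nat 2 := by
      rintro _ _ rfl rfl
      funext i
      rcases eq_or_ne i v with rfl | hv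
      · simp
      · rcases eq_or_ne i u with rfl | hu
        · simp [hne]
        · simp [hu, hv]
    rcases Nat.eq_zero_or_pos (s.nat 2 u) with h0 | h0
    · have h3 : s.nat 2 v = 1 := by omega
      simp [adjProgram, Program.eff, NatExpr.eval, Store.writeNat, ← hu, ← hv, OracleAdj,
        hne, hne.symm, h0, h3, Store.readSet, hup h0 h3]
    · have h0 : s.nat 2 u = 1 := by omega
      have h3 : s.nat 2 v = 0 := by omega
      simp [adjProgram, Program.eff, NatExpr.eval, Store.writeNat, ← hu, ← hv, OracleAdj,
        hne, hne.symm, h0, h3, Store.readSet, hup h0 h3]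

/-- The arc is tested beforehand, so the relation is the trivial one here; `relax_congr` puts the
actual one back. -/
lemma runs_updateProgram : Runs M (.seq arcLabelProgram updateProgram) s 100 fun s' =>
    s'.labels = relax (fun _ _ => True) (oracleLabel (s.nat 0 0) (s.nat 2) (s.group 1))
      (s.nat 9 0) (s.nat 10 0) s.labels := by
  refine Runs.of_loopFree rfl (by decide) ?_
  rw [Program.eff]
  obtain ⟨g, hg, hs⟩ : ∃ g, (g, (if s.nat 10 0 = s.nat 0 0 then 1 else 0 : ℤ)) =
      oracleLabel (s.nat 0 0) (s.nat 2) (s.group 1) (s.nat 10 0) ∧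
      arcLabelProgram.eff M s = s.writeGroup 4 0 g := by
    by_cases h : s.nat 2 (s.nat 10 0) = 0
    · exact ⟨s.group 1 (s.nat 10 0), by simp [oracleLabel, h],
        by simp [arcLabelProgram, Program.eff, NatExpr.eval, GroupExpr.eval, h]⟩
    · exact ⟨-s.group 1 (s.nat 10 0), by simp [oracleLabel, h],
        by simp [arcLabelProgram, Program.eff, NatExpr.eval, GroupExpr.eval, h]⟩
  rw [hs, relax, ← hg]
  set u := s.nat 9 0 with hu
  set v := s.nat 10 0 with hv
  have hlab : ∀ (x y : ℕ), (s.nat 6 x : ℤ) + (if v = s.nat 0 0 then 1 else 0) = s.nat 6 y ↔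
      s.nat 6 x + (if v = s.nat 0 0 then 1 else 0) = s.nat 6 y := by
    intro x y
    split_ifs <;> norm_cast
  by_cases h1 : s.nat 5 u = 0
  · simp [updateProgram, Program.eff, NatExpr.eval, Store.writeGroup, ← hu, h1, Store.labels]
  by_cases h2 : s.nat 5 v = 0
  · simp [updateProgram, Program.eff, NatExpr.eval, GroupExpr.eval, Store.writeGroup,
      Store.writeNat, ← hu, ← hv, h1, h2, Store.labels]
    funext i
    rcases eq_or_ne i v with rfl | hi
    · simp only [Function.update_self]
      split_ifs <;> simp
    · simp [hi]
  by_cases h3 : s.group 2 u + g = s.group 2 v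
  · by_cases h4 : s.nat 5 u = 1
    · by_cases h5 : s.nat 6 u + (if v = s.nat 0 0 then 1 else 0) = s.nat 6 v <;>
        simp [updateProgram, Program.eff, NatExpr.eval, GroupExpr.eval, Store.writeGroup,
          Store.writeNat, ← hu, ← hv, h2, h3, h4, h5, Store.labels, hlab]
    · by_cases h5 : s.nat 6 u + (if v = s.nat 0 0 then 1 else 0) = s.nat 6 v <;>
        simp [updateProgram, Program.eff, NatExpr.eval, GroupExpr.eval, Store.writeGroup,
          Store.writeNat, ← hu, ← hv, h1, h2, h3, h4, h5, Store.labels, hlab]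
  · have h3' : s.group 2 u + g + -s.group 2 v ≠ 0 := by
      rwa [← sub_eq_add_neg, sub_ne_zero]
    have h6 : ¬ 2 < (if s.nat 5 u = 1 then 1 else 0) + (if s.nat 6 u +
        (if v = s.nat 0 0 then 1 else 0) = s.nat 6 v then 1 else 0) := by
      split_ifs <;> omega
    simp [updateProgram, Program.eff, NatExpr.eval, GroupExpr.eval, Store.writeGroup,
      Store.writeNat, ← hu, ← hv, h1, h2, h3, h3', h6, Store.labels]

lemma relax_congr {Λ : Type*} [AddCommGroup Λ] {A A' : ℕ → ℕ → Prop} {ℓ : ℕ → Λ} {u v : ℕ}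
    {p : (ℕ → ℕ) × (ℕ → Λ)} (h : A u v ↔ A' u v) : relax A ℓ u v p = relax A' ℓ u v p := by
  by_cases hA : A u v
  · simp [relax, hA, h.1 hA]
  · have hA' : ¬ A' u v := fun h' => hA (h.2 h')
    simp [relax, hA, hA']

lemma relax_of_not {Λ : Type*} [AddCommGroup Λ] {A : ℕ → ℕ → Prop} {ℓ : ℕ → Λ} {u v : ℕ}
    {p : (ℕ → ℕ) × (ℕ → Λ)} (h : ¬ A u v) : relax A ℓ u v p = p := by
  unfold relax
  simp [h]

lemma runs_relaxProgram (hb : ∀ i, s.nat 2 i ≤ 1) (hu : s.nat 9 0 < N) (hv : s.nat 10 0 < N) :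
    Runs M relaxProgram s 300 fun s' => s'.nat 2 = s.nat 2 ∧
      s'.labels = relax (restrictRel (OracleAdj M (s.nat 2)) (supportBelow N (s.nat 4)))
        (oracleLabel (s.nat 0 0) (s.nat 2) (s.group 1)) (s.nat 9 0) (s.nat 10 0) s.labels := by
  classical
  have hskip : ∀ {s' : Store Γ} {T : ℕ} {A : Store Γ → Prop}, 1 ≤ T → A s' →
      Runs M .skip s' T A := fun h1 h2 => Runs.of_loopFree rfl h1 h2
  refine ((runs_adjProgram hb).agree.seq (T' := 200) (A' := _) fun s₁ h₁ => ?_).mono (by norm_num)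
    fun _ h => h
  obtain ⟨⟨h2, h13⟩, hag⟩ := h₁
  have e9 : s₁.nat 9 = s.nat 9 := hag.1 9 rfl
  have e10 : s₁.nat 10 = s.nat 10 := hag.1 10 rfl
  have e4 : s₁.nat 4 = s.nat 4 := hag.1 4 rfl
  have e0 : s₁.nat 0 = s.nat 0 := hag.1 0 rfl
  have eg : s₁.group 1 = s.group 1 := hag.2 1 rfl
  have el : s₁.labels = s.labels := by
    simp only [Store.labels]
    rw [hag.1 5 rfl, hag.1 6 rfl, hag.2 2 rfl]
  have hadj : restrictRel (OracleAdj M (s.nat 2)) (supportBelow N (s.nat 4)) (s.nat 9 0)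
      (s.nat 10 0) ↔ s.nat 4 (s.nat 9 0) ≠ 0 ∧ s.nat 4 (s.nat 10 0) ≠ 0 ∧
        OracleAdj M (s.nat 2) (s.nat 9 0) (s.nat 10 0) := by
    simp [restrictRel, supportBelow, hu, hv]
  have hno : ∀ {T}, 1 ≤ T → ¬ restrictRel (OracleAdj M (s.nat 2)) (supportBelow N (s.nat 4))
      (s.nat 9 0) (s.nat 10 0) → Runs M .skip s₁ T fun s' => s'.nat 2 = s.nat 2 ∧
      s'.labels = relax (restrictRel (OracleAdj M (s.nat 2)) (supportBelow N (s.nat 4)))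
        (oracleLabel (s.nat 0 0) (s.nat 2) (s.group 1)) (s.nat 9 0) (s.nat 10 0) s.labels :=
    fun hT h => hskip hT ⟨h2, by rw [relax_of_not h, el]⟩
  refine (Runs.cond (T := 150) (fun hc => (Runs.cond (T := 130) (fun hc1 =>
    (Runs.cond (T := 100) (fun hc2 => ?_) fun hc2 => hno (by norm_num) fun h => ?_).mono
      (T := _) (by decide) fun _ h => h) fun hc1 => hno (by norm_num) fun h => ?_).mono
      (by decide) fun _ h => h) fun hc => hno (by norm_num) fun h => ?_).mono (by decide)
      fun _ h => h
  · refine runs_updateProgram.agree.mono le_rfl fun s₂ h₂ => ?_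
    obtain ⟨h, hag₂⟩ := h₂
    rw [e0, h2, eg, e9, e10, el] at h
    refine ⟨(hag₂.1 2 rfl).trans h2, h.trans (relax_congr ?_)⟩
    simp only [NatExpr.eval, h13, e9, e10, e4] at hc hc1 hc2
    rw [hadj]
    simp only [true_iff]
    refine ⟨hc1, hc2, ?_⟩
    by_contra hcon
    simp [hcon] at hc
  · simp only [NatExpr.eval, e4, e10] at hc2
    exact (hadj.1 h).2.1 hc2
  · simp only [NatExpr.eval, e4, e9] at hc1
    exact (hadj.1 h).1 hc1
  · simp only [NatExpr.eval, h13] at hc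
    simp [(hadj.1 h).2.2] at hc

end Programs

/-- `N` rounds of relaxing all arcs. -/
def roundsProgram : Program := forLoop 8 3 (forLoop 9 3 (forLoop 10 3 relaxProgram))

/-- Set the number array `a` to the constant `c` below `N`. -/
def fillProgram (a c : ℕ) : Program := forLoop 17 3 (.setNat a (.var 17) (.lit c))

/-- Add to the flag `14` whether there is a non-zero closed walk through `var 11`. -/
def detectAtProgram : Program :=
  .seq (fillProgram 5 0)
  (.seq (.seq (.setNat 5 (.var 11) (.lit 1))
    (.seq (.setNat 6 (.var 11) (.lit 0)) (.setGroup 2 (.var 11) .zero)))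
  (.seq roundsProgram
    (.cond (.eq (.get 5 (.var 11)) (.lit 2)) (.setNat 14 (.lit 0) (.lit 1)) .skip)))

/-- Compute in the flag `14` whether there is a non-zero closed walk. -/
def detectProgram : Program :=
  .seq (.setNat 14 (.lit 0) (.lit 0)) (forLoop 11 3 detectAtProgram)

/-- Remove `var 12` from the set in the array `4` if a non-zero closed walk remains. -/
def shrinkProgram : Program :=
  .seq (.setNat 4 (.var 12) (.lit 0))
    (.seq detectProgram (.cond (.var 14) .skip (.setNat 4 (.var 12) (.lit 1))))

/-- Replace the set in the array `2` by its symmetric difference with the set in the array `4`. -/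
def toggleProgram : Program :=
  forLoop 17 3 (.cond (.get 4 (.var 17))
    (.setNat 2 (.var 17) (.sub (.lit 1) (.get 2 (.var 17)))) .skip)

/-- Replace the set in the array `2` by its symmetric difference with an inclusion-minimal set that
carries a non-zero closed walk, and compute in the flag `14` whether there is one. -/
def improveProgram : Program :=
  .seq (fillProgram 4 1) (.seq detectProgram (.cond (.var 14)
    (.seq (forLoop 12 3 shrinkProgram) (.seq toggleProgram (.setNat 14 (.lit 0) (.lit 1)))) .skip))

/-- The array `0` holds `n`, the array `2` the set `b`, the array `3` the number `N`, the array `4`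
the set `W`, and the group array `1` the labels `L`. -/
def Holds {Γ : Type*} (n N : ℕ) (b W : ℕ → ℕ) (L : ℕ → Γ) (s : Store Γ) : Prop :=
  s.nat 0 0 = n ∧ s.nat 2 = b ∧ s.nat 3 0 = N ∧ s.nat 4 = W ∧ s.group 1 = L

/-- The running time of `roundsProgram`. -/
def roundsTime (N : ℕ) : ℕ := N * (N * (N * 312 + 21) + 21) + 9

/-- The running time of `detectProgram`. -/
def detectTime (N : ℕ) : ℕ := N * (roundsTime N + N * 17 + 100) + 20

/-- The running time of `improveProgram`. -/
def improveTime (N : ℕ) : ℕ := (N + 1) * (detectTime N + 100) + N * 100 + 100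

/-! ### Correctness of detection, shrinking and exchange. -/

section Detect

variable {n : ℕ} {Γ : Type*} [AddCommGroup Γ] {M : Fin 2 → Matroid (Fin n)} {s s' : Store Γ}
  {b W : ℕ → ℕ} {L : ℕ → Γ} {N x : ℕ}

omit [AddCommGroup Γ] in
lemma Holds.of_agree {P : Program} (h : Holds n N b W L s) (ha : Agree P s s')
    (h0 : P.writesNat 0 = false) (h3 : P.writesNat 3 = false) (h4 : P.writesNat 4 = false)
    (h1 : P.writesGroup 1 = false) (h2 : s'.nat 2 = b) : Holds n N b W L s' :=
  ⟨by rw [ha.1 0 h0]; exact h.1, h2, by rw [ha.1 3 h3]; exact h.2.2.1,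
    (ha.1 4 h4).trans h.2.2.2.1, (ha.2 1 h1).trans h.2.2.2.2⟩

lemma restrictRel_supportBelow_lt {r : ℕ → ℕ → Prop} (u v : ℕ)
    (h : restrictRel r (supportBelow N W) u v) : u < N ∧ v < N :=
  ⟨Finset.mem_range.1 (Finset.mem_filter.1 h.1).1, Finset.mem_range.1 (Finset.mem_filter.1 h.2.1).1⟩

/-- The three nested loops move the invariant `Progress` through `(k, i, j)`: a full inner loop
leads from `(k, i, N)` to `(k, i + 1, 0)`, a full middle loop from `(k, N, 0)` to `(k + 1, 0, 0)`.
-/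
lemma runs_roundsProgram (hb : ∀ i, b i ≤ 1) (hs : Holds n N b W L s)
    (hp : Progress (restrictRel (OracleAdj M b) (supportBelow N W)) (oracleLabel n b L) N x 0 0 0
      s.labels) :
    Runs M roundsProgram s (roundsTime N) fun s' => Holds n N b W L s' ∧
      Progress (restrictRel (OracleAdj M b) (supportBelow N W)) (oracleLabel n b L) N x N 0 0
        s'.labels := by
  refine Runs.forLoop N (fun k s' => Holds n N b W L s' ∧
      Progress (restrictRel (OracleAdj M b) (supportBelow N W)) (oracleLabel n b L) N x k 0 0
        s'.labels) hs.2.2.1 rfl rfl (fun k s v h => h) ⟨hs, hp⟩ fun k hk s₁ e₁ ag₁ ⟨hs₁, hp₁⟩ => ?_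
  refine (Runs.forLoop (i := 9) N (T := N * 312 + 9) (fun i s' => Holds n N b W L s' ∧
      Progress (restrictRel (OracleAdj M b) (supportBelow N W)) (oracleLabel n b L) N x k i 0
        s'.labels) hs₁.2.2.1 rfl rfl (fun k s v h => h) ⟨hs₁, hp₁⟩
        fun i hi s₂ e₂ ag₂ ⟨hs₂, hp₂⟩ => ?_).mono (by rw [add_assoc]) fun s' h =>
        ⟨h.1, h.2.next_length restrictRel_supportBelow_lt⟩
  refine (Runs.forLoop (i := 10) N (T := 300) (fun j s' => Holds n N b W L s' ∧
      Progress (restrictRel (OracleAdj M b) (supportBelow N W)) (oracleLabel n b L) N x k i j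
        s'.labels) hs₂.2.2.1 rfl rfl (fun k s v h => h) ⟨hs₂, hp₂⟩
        fun j hj s₃ e₃ ag₃ ⟨hs₃, hp₃⟩ => ?_).mono le_rfl fun s' h =>
        ⟨h.1, h.2.next_tail restrictRel_supportBelow_lt⟩
  have e9 : s₃.nat 9 0 = i := by rw [ag₃.1 9 rfl, e₂]
  have hs₃' := hs₃
  obtain ⟨h0, h2, h3, h4, h1⟩ := hs₃'
  refine (runs_relaxProgram (N := N) (by rwa [h2]) (by omega) (by omega)).agree.mono le_rfl
    fun s' h => ?_
  obtain ⟨⟨h5, h6⟩, ag⟩ := h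
  refine ⟨hs₃.of_agree ag rfl rfl rfl rfl (h5.trans h2), ?_⟩
  rw [h6, e9, e₃, h0, h1, h2, h4]
  exact hp₃.relax restrictRel_supportBelow_lt

lemma runs_fillProgram (a c : ℕ) (ha : a ≠ 17) (ha3 : a ≠ 3) (hN : s.nat 3 0 = N) :
    Runs M (fillProgram a c) s (N * 17 + 9) fun s' => ∀ i < N, s'.nat a i = c := by
  have e3 : (a == 3) = false := by simpa using ha3
  have e17 : (a == 17) = false := by simpa using ha
  refine (Runs.forLoop N (T := 5) (fun k s' => ∀ i < k, s'.nat a i = c) hN ?_ ?_ ?_ ?_ ?_).mono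
    (by omega) fun _ h => h
  · simp [forLoop, Program.writesNat, e3]
  · simp [Program.writesNat, e17]
  · intro k s v h
    simpa [Store.writeNat, ha] using h
  · simp
  · intro k hk s₁ e₁ _ h
    refine Runs.of_loopFree rfl (by simp [Program.maxCost, NatExpr.cost]) ?_
    intro i hi
    simp only [Program.eff, NatExpr.eval, e₁, Store.writeNat, Function.update_self]
    rcases eq_or_ne i k with rfl | hne
    · simp
    · rw [Function.update_of_ne hne]
      exact h i (by omega)

/-- The flag is only ever raised, so the answers for different starting vertices accumulate to their
disjunction. -/
lemma runs_detectAtProgram (hb : ∀ i, b i ≤ 1) (hs : Holds n N b W L s) (hx : s.nat 11 0 = x)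
    (hxN : x < N) :
    Runs M detectAtProgram s (roundsTime N + N * 17 + 88) fun s' =>
      Holds n N b W L s' ∧
      (s'.nat 14 0 ≠ 0 → s.nat 14 0 ≠ 0 ∨ HasNonZeroClosedWalk
        (restrictRel (OracleAdj M b) (supportBelow N W)) (oracleLabel n b L)) ∧
      (s.nat 14 0 ≠ 0 → s'.nat 14 0 ≠ 0) ∧
      ∀ m, DWalk (restrictRel (OracleAdj M b) (supportBelow N W)) x x m → m.card ≤ N →
        walkLabel (oracleLabel n b L) m ≠ 0 → s'.nat 14 0 ≠ 0 := by
  refine ((runs_fillProgram (N := N) 5 0 (by decide) (by decide) hs.2.2.1).agree.seq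
    (T' := 30 + (roundsTime N + 30))
    (A' := _) fun s₁ ⟨h₁, ag₁⟩ => ?_).mono (by omega) fun _ h => h
  have hs₁ := hs.of_agree ag₁ rfl rfl rfl rfl ((ag₁.1 2 rfl).trans hs.2.1)
  have hx₁ : s₁.nat 11 0 = x := by rw [ag₁.1 11 rfl, hx]
  refine Runs.seq (T := 30) (A := fun s₂ => Holds n N b W L s₂ ∧ s₂.nat 11 0 = x ∧
    s₂.nat 14 = s.nat 14 ∧ Progress (restrictRel (OracleAdj M b) (supportBelow N W))
    (oracleLabel n b L) N x 0 0 0 s₂.labels) ?_ ?_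
  · refine Runs.of_loopFree rfl (by decide) ?_
    simp only [Program.eff, NatExpr.eval, GroupExpr.eval]
    -- Labels left over from earlier starting vertices need no erasing: they are not read while the
    -- count of their vertex is zero.
    refine ⟨hs₁, hx₁, ag₁.1 14 rfl, Progress.init hxN (fun v hv => ?_) ?_⟩
    · simp [Store.labels, Store.writeNat, Store.writeGroup, hx₁, Function.update_apply, h₁ v hv]
    · simp [Store.labels, Store.writeNat, Store.writeGroup, hx₁]
  · rintro s₂ ⟨hs₂, hx₂, e14, hp₂⟩
    refine Runs.seq (runs_roundsProgram hb hs₂ hp₂).agree fun s₃ ⟨⟨hs₃, hp₃⟩, ag₃⟩ => ?_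
    have hx₃ : s₃.nat 11 0 = x := by rw [ag₃.1 11 rfl, hx₂]
    have e14₃ : s₃.nat 14 0 = s.nat 14 0 := by rw [ag₃.1 14 rfl, e14]
    refine Runs.of_loopFree rfl (by decide) ?_
    by_cases hr : s₃.nat 5 x = 2
    · have : Program.eff M (.cond (.eq (.get 5 (.var 11)) (.lit 2))
          (.setNat 14 (.lit 0) (.lit 1)) .skip) s₃ = s₃.writeNat 14 0 1 := by
        simp [Program.eff, NatExpr.eval, hx₃, hr]
      rw [this]
      exact ⟨hs₃, fun _ => .inr (hp₃.hasNonZeroClosedWalk hxN hr), fun _ => one_ne_zero,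
        fun _ _ _ _ => one_ne_zero⟩
    · have : Program.eff M (.cond (.eq (.get 5 (.var 11)) (.lit 2))
          (.setNat 14 (.lit 0) (.lit 1)) .skip) s₃ = s₃ := by
        simp [Program.eff, NatExpr.eval, hx₃, hr]
      rw [this, e14₃]
      exact ⟨hs₃, .inl, id, fun m hm hk hl => absurd (hp₃.eq_two hm hk hl) hr⟩

lemma runs_detectProgram (hb : ∀ i, b i ≤ 1) (hs : Holds n N b W L s) :
    Runs M detectProgram s (detectTime N) fun s' => Holds n N b W L s' ∧
      (s'.nat 14 0 ≠ 0 ↔ HasNonZeroClosedWalk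
        (restrictRel (OracleAdj M b) (supportBelow N W)) (oracleLabel n b L)) := by
  refine Runs.mono (T := 3 + (N * (roundsTime N + N * 17 + 88 + 12) + 9)) (A := _) ?_
    (by rw [detectTime, add_assoc (roundsTime N + N * 17)]; omega) fun _ h => h
  refine Runs.seq (A := fun s₁ => Holds n N b W L s₁ ∧ s₁.nat 14 0 = 0)
    (Runs.of_loopFree rfl (by decide) ⟨hs, rfl⟩) fun s₁ ⟨hs₁, e14⟩ => ?_
  refine (Runs.forLoop (i := 11) N (fun k s' => Holds n N b W L s' ∧
      (s'.nat 14 0 ≠ 0 → HasNonZeroClosedWalk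
        (restrictRel (OracleAdj M b) (supportBelow N W)) (oracleLabel n b L)) ∧
      ∀ x < k, ∀ m, DWalk (restrictRel (OracleAdj M b) (supportBelow N W)) x x m → m.card ≤ N →
        walkLabel (oracleLabel n b L) m ≠ 0 → s'.nat 14 0 ≠ 0) hs₁.2.2.1 rfl rfl
      (fun k s v h => h) ⟨hs₁, by simp [e14], by simp⟩ fun k hk s₂ e₂ _ ⟨hs₂, h₂, h₂'⟩ => ?_).mono
      le_rfl fun s₃ ⟨h₃, h₄, h₅⟩ => ⟨h₃, h₄, fun h => ?_⟩
  · refine (runs_detectAtProgram hb hs₂ e₂ hk).mono le_rfl fun s₃ ⟨hs₃, h₃, h₃', h₃''⟩ =>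
      ⟨hs₃, fun h => (h₃ h).elim h₂ id, fun x hx m hm hc hl => ?_⟩
    rcases Nat.lt_succ_iff_lt_or_eq.1 hx with hx | rfl
    · exact h₃' (h₂' x hx m hm hc hl)
    · exact h₃'' m hm hc hl
  -- A non-zero closed walk without repetition enters at most `N` vertices, so `N` rounds from its
  -- starting vertex find it.
  · obtain ⟨v, m, hm, hl, hd⟩ := h.exists_nodup
    have hm0 : m ≠ 0 := by
      rintro rfl
      simp at hl
    have hlt : ∀ y ∈ m, y < N := fun y hy => by
      obtain ⟨z, hz⟩ := hm.exists_rel_of_mem hy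
      exact (restrictRel_supportBelow_lt _ _ hz).2
    refine h₅ v (hlt v (hm.last_mem hm0)) m hm ?_ hl
    have := Multiset.card_le_card (Multiset.le_iff_subset hd |>.2 fun y hy =>
      Multiset.mem_range.2 (hlt y hy))
    simpa using this

lemma supportBelow_update_zero (k : ℕ) :
    supportBelow N (Function.update W k 0) = (supportBelow N W).erase k := by
  ext i
  rcases eq_or_ne i k with rfl | hi
  · simp [supportBelow]
  · simp [supportBelow, hi]

lemma supportBelow_update_update (k : ℕ) (hk : W k ≠ 0) :
    supportBelow N (Function.update (Function.update W k 0) k 1) = supportBelow N W := by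
  ext i
  rcases eq_or_ne i k with rfl | hi
  · simp [supportBelow, hk]
  · simp [supportBelow, hi]

/-- One pass gives an inclusion-minimal set, because carrying a non-zero closed walk is monotone: an
element that could not be deleted from a larger set cannot be deleted later. -/
lemma runs_shrinkProgram (hb : ∀ i, b i ≤ 1) (hs : s.nat 0 0 = n ∧ s.nat 2 = b ∧ s.nat 3 0 = N)
    (hL : s.group 1 = L)
    (hW : HasNonZeroClosedWalk (restrictRel (OracleAdj M b) (supportBelow N (s.nat 4)))
      (oracleLabel n b L)) (hfull : ∀ i < N, s.nat 4 i ≠ 0) :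
    Runs M (forLoop 12 3 shrinkProgram) s (N * (detectTime N + 30) + 9) fun s' =>
      s'.nat 2 = b ∧ HasNonZeroClosedWalk
        (restrictRel (OracleAdj M b) (supportBelow N (s'.nat 4))) (oracleLabel n b L) ∧
      ∀ w ∈ supportBelow N (s'.nat 4), ¬ HasNonZeroClosedWalk
        (restrictRel (OracleAdj M b) ((supportBelow N (s'.nat 4)).erase w))
        (oracleLabel n b L) := by
  refine (Runs.forLoop (i := 12) (T := 4 + (detectTime N + 14)) N (fun k s' =>
      s'.nat 2 = b ∧ HasNonZeroClosedWalk
        (restrictRel (OracleAdj M b) (supportBelow N (s'.nat 4))) (oracleLabel n b L) ∧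
      (∀ w < k, w ∈ supportBelow N (s'.nat 4) → ¬ HasNonZeroClosedWalk
        (restrictRel (OracleAdj M b) ((supportBelow N (s'.nat 4)).erase w)) (oracleLabel n b L)) ∧
      ∀ w < N, k ≤ w → s'.nat 4 w ≠ 0) hs.2.2 rfl rfl (fun k s v h => h)
      ⟨hs.2.1, hW, by simp, fun w hw _ => hfull w hw⟩ ?_).mono
      (by rw [show 4 + (detectTime N + 14) + 12 = detectTime N + 30 by omega]) ?_
  swap
  · rintro s' ⟨h2, h3, h4, -⟩
    exact ⟨h2, h3, fun w hw => h4 w (Finset.mem_range.1 (Finset.mem_filter.1 hw).1) hw⟩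
  rintro k hk s₁ e₁ ag₁ ⟨h2, h3, h4, h5⟩
  have hs₁ : Holds n N b (Function.update (s₁.nat 4) k 0) L (s₁.writeNat 4 k 0) :=
    ⟨by rw [← hs.1, ← ag₁.1 0 rfl]; rfl, h2, by rw [← hs.2.2, ← ag₁.1 3 rfl]; rfl, rfl,
      by rw [← hL, ← ag₁.2 1 rfl]; rfl⟩
  refine Runs.seq (A := fun s₂ => Holds n N b (Function.update (s₁.nat 4) k 0) L s₂ ∧
    s₂.nat 12 0 = k) (Runs.of_loopFree rfl (by decide) ?_) fun s₂ ⟨hs₂, e₂⟩ => ?_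
  · simp only [Program.eff, NatExpr.eval, e₁]
    exact ⟨hs₁, e₁⟩
  refine Runs.seq (runs_detectProgram hb hs₂).agree fun s₃ ⟨⟨hs₃, hiff⟩, ag₃⟩ => ?_
  rw [supportBelow_update_zero] at hiff
  have e₃ : s₃.nat 12 0 = k := by rw [ag₃.1 12 rfl, e₂]
  refine Runs.of_loopFree rfl (by decide) ?_
  simp only [Program.eff, NatExpr.eval, e₃]
  split_ifs with h14
  · have hno := fun h => hiff.2 h h14
    have he : (s₃.writeNat 4 k 1).nat 4 = Function.update (Function.update (s₁.nat 4) k 0) k 1 := by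
      simp [Store.writeNat, hs₃.2.2.2.1]
    -- The element `k` had not been treated before, so it was present and writing `1` restores the
    -- set.
    have hsupp : supportBelow N ((s₃.writeNat 4 k 1).nat 4) = supportBelow N (s₁.nat 4) := by
      rw [he, supportBelow_update_update k (h5 k hk le_rfl)]
    rw [hsupp]
    refine ⟨hs₃.2.1, h3, fun w hw hws => ?_, fun w hw hkw => ?_⟩
    · rcases Nat.lt_succ_iff_lt_or_eq.1 hw with hw | rfl
      · exact h4 w hw hws
      · exact hno
    · rw [he, Function.update_of_ne (by omega), Function.update_of_ne (by omega)]
      exact h5 w hw (by omega)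
  · rw [hs₃.2.2.2.1, supportBelow_update_zero]
    refine ⟨hs₃.2.1, hiff.1 h14, fun w hw hws h => ?_, fun w hw hkw => ?_⟩
    · rw [Finset.mem_erase] at hws
      exact h4 w (by omega) hws.2
        (h.mono (restrictRel.mono (Finset.erase_subset_erase _ (Finset.erase_subset _ _))))
    · rw [Function.update_of_ne (by omega)]
      exact h5 w hw (by omega)

lemma runs_toggleProgram (hN : s.nat 3 0 = N) : Runs M toggleProgram s (N * 40 + 9) fun s' =>
    ∀ i, s'.nat 2 i = if i ∈ supportBelow N (s.nat 4) then 1 - s.nat 2 i else s.nat 2 i := by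
  refine (Runs.forLoop (i := 17) (T := 28) N (fun k s' => ∀ i, s'.nat 2 i =
    if i < k ∧ i ∈ supportBelow N (s.nat 4) then 1 - s.nat 2 i else s.nat 2 i) hN rfl rfl
    (fun k s v h => h) (by simp) ?_).mono le_rfl ?_
  swap
  · intro s' h i
    rw [h i]
    refine if_congr ?_ rfl rfl
    simp +contextual [supportBelow]
  intro k hk s₁ e₁ ag₁ h
  refine Runs.of_loopFree rfl (by decide) fun i => ?_
  have e4 : s₁.nat 4 = s.nat 4 := ag₁.1 4 rfl
  simp only [Program.eff, NatExpr.eval, e₁, e4]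
  have hk2 : s₁.nat 2 k = s.nat 2 k := by rw [h k]; simp
  by_cases h4 : s.nat 4 k = 0
  · rw [if_pos h4, h i]
    refine if_congr ⟨fun h => ⟨by omega, h.2⟩, fun h => ⟨?_, h.2⟩⟩ rfl rfl
    have : i ≠ k := by
      rintro rfl
      exact (Finset.mem_filter.1 h.2).2 h4
    omega
  · rw [if_neg h4]
    rcases eq_or_ne i k with rfl | hne
    · simp [Store.writeNat, supportBelow, hk, h4, hk2]
    · simp only [Store.writeNat, Function.update_self, Function.update_of_ne hne]
      rw [h i]
      exact if_congr ⟨fun h => ⟨by omega, h.2⟩, fun h => ⟨by omega, h.2⟩⟩ rfl rfl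

lemma runs_improveProgram (h0 : s.nat 0 0 = n) (hN : s.nat 3 0 = N) (hb : ∀ i, s.nat 2 i ≤ 1) :
    Runs M improveProgram s (improveTime N) fun s' =>
      (s'.nat 14 0 = 0 ∧ s'.nat 2 = s.nat 2 ∧ ¬ HasNonZeroClosedWalk
        (restrictRel (OracleAdj M (s.nat 2)) (Finset.range N))
        (oracleLabel n (s.nat 2) (s.group 1))) ∨
      (s'.nat 14 0 ≠ 0 ∧ ∃ W ⊆ Finset.range N,
        HasNonZeroClosedWalk (restrictRel (OracleAdj M (s.nat 2)) W)
          (oracleLabel n (s.nat 2) (s.group 1)) ∧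
        (∀ w ∈ W, ¬ HasNonZeroClosedWalk (restrictRel (OracleAdj M (s.nat 2)) (W.erase w))
          (oracleLabel n (s.nat 2) (s.group 1))) ∧
        ∀ i, s'.nat 2 i = if i ∈ W then 1 - s.nat 2 i else s.nat 2 i) := by
  set b := s.nat 2 with hb'
  set L := s.group 1 with hL
  refine Runs.mono (T := N * 17 + 9 + (detectTime N + (3 + ((N * (detectTime N + 30) + 9) +
    (N * 40 + 9 + 3))))) (A := _) ?_ ?_ fun _ h => h
  swap
  · rw [improveTime, add_mul, mul_add, mul_add]
    omega
  refine Runs.seq (runs_fillProgram 4 1 (by decide) (by decide) hN).agree fun s₁ ⟨h₁, ag₁⟩ => ?_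
  have hs₁ : Holds n N b (s₁.nat 4) L s₁ :=
    ⟨by rw [ag₁.1 0 rfl, h0], ag₁.1 2 rfl, by rw [ag₁.1 3 rfl, hN], rfl, ag₁.2 1 rfl⟩
  have hsupp : supportBelow N (s₁.nat 4) = Finset.range N := by
    refine Finset.filter_true_of_mem fun i hi => ?_
    rw [h₁ i (Finset.mem_range.1 hi)]
    exact one_ne_zero
  refine Runs.seq (runs_detectProgram hb hs₁).agree fun s₂ ⟨⟨hs₂, hiff⟩, ag₂⟩ => ?_
  rw [hsupp] at hiff
  refine Runs.cond (fun hc => ?_) (fun hc => ?_)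
  swap
  · refine Runs.of_loopFree rfl ?_ (.inl ⟨hc, hs₂.2.1, fun h => hiff.2 h hc⟩)
    simp only [Program.maxCost]
    omega
  have h14 : HasNonZeroClosedWalk (restrictRel (OracleAdj M b) (Finset.range N))
      (oracleLabel n b L) := hiff.1 hc
  have e4 : s₂.nat 4 = s₁.nat 4 := hs₂.2.2.2.1
  refine Runs.seq (runs_shrinkProgram (N := N) (L := L) hb ⟨hs₂.1, hs₂.2.1, hs₂.2.2.1⟩
    hs₂.2.2.2.2 (by rw [e4, hsupp]; exact h14) (fun i hi => by rw [e4, h₁ i hi]; simp)).agree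
    fun s₃ ⟨⟨hb₃, hW₃, hmin₃⟩, ag₃⟩ => ?_
  have hN₃ : s₃.nat 3 0 = N := by rw [ag₃.1 3 rfl, hs₂.2.2.1]
  refine Runs.seq (runs_toggleProgram hN₃) fun s₄ h₄ => Runs.of_loopFree rfl (by decide) ?_
  rw [hb₃] at h₄
  exact .inr ⟨one_ne_zero, supportBelow N (s₃.nat 4), Finset.filter_subset _ _, hW₃, hmin₃, h₄⟩

end Detect

/-! ### Matroids on initial segments of the natural numbers -/

/-- The elements of `Fin n` that belong to `S`. -/
def cells (n : ℕ) (S : Finset ℕ) : Set (Fin n) := {e | (e : ℕ) ∈ S}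

section FreeTruncation

variable {n : ℕ}

lemma cells_mono {S T : Finset ℕ} (h : S ⊆ T) : cells n S ⊆ cells n T := fun _ he => h he

lemma encard_cells (S : Finset ℕ) : (cells n S).encard = (S.filter (· < n)).card := by
  have : cells n S = Fin.val ⁻¹' (S.filter (· < n) : Finset ℕ) := by
    ext e
    simp [cells]
  rw [this, Set.encard_preimage_of_injective_subset_range Fin.val_injective,
    Set.encard_coe_eq_coe_finsetCard]
  intro i hi
  have := (Finset.mem_filter.1 (Finset.mem_coe.1 hi)).2
  exact ⟨⟨i, this⟩, rfl⟩

/-- The truncation to rank `k` of the direct sum of `M` and the free matroid on the numbers from `n`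
to `N - 1`. -/
def freeTruncation (M : Matroid (Fin n)) (N k : ℕ) : Matroid ℕ :=
  (IndepMatroid.ofFinset (Finset.range N : Set ℕ)
    (fun S => M.Indep (cells n S) ∧ S.card ≤ k ∧ S ⊆ Finset.range N)
    ⟨by simp [cells], by simp, by simp⟩
    (fun _ _ hJ hIJ => ⟨hJ.1.subset (cells_mono hIJ), (Finset.card_le_card hIJ).trans hJ.2.1,
      hIJ.trans hJ.2.2⟩)
    (by
      rintro I J ⟨hI, hIk, hIN⟩ ⟨hJ, hJk, hJN⟩ hIJ
      have hins : ∀ e ∈ J, e ∉ I → M.Indep (cells n (insert e I)) → ∃ e ∈ J, e ∉ I ∧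
          M.Indep (cells n (insert e I)) ∧ (insert e I).card ≤ k ∧ insert e I ⊆ Finset.range N :=
        fun e heJ heI h => ⟨e, heJ, heI, h, by rw [Finset.card_insert_of_notMem heI]; omega,
          Finset.insert_subset (hJN heJ) hIN⟩
      -- A free element of `J` outside `I` can be added at once. Otherwise the surplus of `J` lies
      -- below `n`, and `M` provides the augmenting element.
      by_cases hex : ∃ e ∈ J, n ≤ e ∧ e ∉ I
      · obtain ⟨e, heJ, hen, heI⟩ := hex
        refine hins e heJ heI ?_
        have : cells n (insert e I) = cells n I := by
          ext x
          have := x.2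
          simp only [cells, Set.mem_ofPred, Finset.mem_insert, or_iff_right_iff_imp]
          omega
        rwa [this]
      · push Not at hex
        have hlt : (cells n I).encard < (cells n J).encard := by
          rw [encard_cells, encard_cells, Nat.cast_lt]
          have h1 := Finset.card_filter_add_card_filter_not (s := I) (· < n)
          have h2 := Finset.card_filter_add_card_filter_not (s := J) (· < n)
          have h3 : (J.filter (¬ · < n)).card ≤ (I.filter (¬ · < n)).card := by
            refine Finset.card_le_card fun e he => ?_
            rw [Finset.mem_filter, not_lt] at he ⊢
            exact ⟨hex e he.1 he.2, he.2⟩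
          omega
        obtain ⟨e, ⟨heJ, heI⟩, he⟩ := hI.exists_insert_of_encard_lt hJ hlt
        refine hins e heJ heI ?_
        have : cells n (insert (e : ℕ) I) = insert e (cells n I) := by
          ext x
          simp [cells, Fin.ext_iff]
        rwa [this])
    (fun I hI => by exact_mod_cast hI.2.2)).matroid

lemma freeTruncation_indep {M : Matroid (Fin n)} {N k : ℕ} {S : Finset ℕ} :
    (freeTruncation M N k).Indep (S : Set ℕ) ↔
      M.Indep (cells n S) ∧ S.card ≤ k ∧ S ⊆ Finset.range N := by
  rw [freeTruncation, IndepMatroid.matroid_indep_iff, IndepMatroid.ofFinset_indep]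

/-- Truncating to the size of the current independent set makes that set a basis, and every
independent set of the same size as well. An independence query thus decides whether an exchange
leads to a basis. -/
lemma freeTruncation_isBase {M : Matroid (Fin n)} {N : ℕ} {S T : Finset ℕ}
    (hS : M.Indep (cells n S)) (hSN : S ⊆ Finset.range N) :
    (freeTruncation M N S.card).IsBase (T : Set ℕ) ↔
      M.Indep (cells n T) ∧ T.card = S.card ∧ T ⊆ Finset.range N := by
  have hSI : (freeTruncation M N S.card).Indep (S : Set ℕ) :=
    freeTruncation_indep.2 ⟨hS, le_rfl, hSN⟩
  have hSB : (freeTruncation M N S.card).IsBase (S : Set ℕ) := by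
    obtain ⟨B, hB, hSB⟩ := hSI.exists_isBase_superset
    have hBN : B ⊆ (Finset.range N : Set ℕ) := hB.subset_ground
    lift B to Finset ℕ using (Finset.finite_toSet _).subset hBN
    have h1 := (freeTruncation_indep.1 hB.indep).2.1
    have h2 := Finset.eq_of_subset_of_card_le (Finset.coe_subset.1 hSB) h1
    rwa [← h2] at hB
  constructor
  · intro hT
    have := freeTruncation_indep.1 hT.indep
    exact ⟨this.1, hSB.card_eq_of_finset hT, this.2.2⟩
  · rintro ⟨hT, hc, hTN⟩
    exact Matroid.Indep.isBase_of_card_eq hSB (freeTruncation_indep.2 ⟨hT, hc.le, hTN⟩) hc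

end FreeTruncation

/-! ### The improvement step -/

section Improve

variable {n : ℕ} {Γ : Type*} [AddCommGroup Γ] {M : Fin 2 → Matroid (Fin n)} {s : Store Γ}
  {N : ℕ} {b : ℕ → ℕ} {L : ℕ → Γ}

/-- The labels of elements. The second component of a set says whether `n` belongs to it. -/
def elementLabel (n : ℕ) (L : ℕ → Γ) (v : ℕ) : Γ × ℤ := (L v, if v = n then -1 else 0)

/-- `S` is independent in both matroids, where the elements from `n` to `N - 1` are free. -/
def CommonIndep (M : Fin 2 → Matroid (Fin n)) (N : ℕ) (S : Finset ℕ) : Prop :=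
  S ⊆ Finset.range N ∧ ∀ j, (M j).Indep (cells n S)

lemma hasNonZeroClosedWalk_congr {α Λ : Type*} [AddCommGroup Λ] {r r' : α → α → Prop}
    {ℓ ℓ' : α → Λ} {W : Finset α} (hr : ∀ u ∈ W, ∀ v ∈ W, (r u v ↔ r' u v))
    (hℓ : ∀ u ∈ W, ℓ u = ℓ' u) :
    HasNonZeroClosedWalk (restrictRel r W) ℓ ↔ HasNonZeroClosedWalk (restrictRel r' W) ℓ' := by
  have : restrictRel r W = restrictRel r' W := by
    funext u v
    exact propext ⟨fun h => ⟨h.1, h.2.1, (hr u h.1 v h.2.1).1 h.2.2⟩,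
      fun h => ⟨h.1, h.2.1, (hr u h.1 v h.2.1).2 h.2.2⟩⟩
  rw [this]
  refine exists_congr fun v => exists_congr fun m => and_congr_right fun hm => ?_
  have : walkLabel ℓ m = walkLabel ℓ' m := by
    unfold walkLabel
    congr 1
    refine Multiset.map_congr rfl fun x hx => hℓ x ?_
    obtain ⟨y, hy⟩ := hm.exists_rel_of_mem hx
    exact hy.2.1
  rw [this]

lemma cells_exchange (hnN : n ≤ N) {x y : ℕ} (hxy : x ≠ y) (hb : ∀ i, b i ≤ 1) (hx : b x ≠ 0)
    (hy : b y = 0) :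
    cells n (insert y ((supportBelow N b).erase x)) =
      {e : Fin n | Function.update (Function.update b x (1 - b x)) y (1 - b y) e ≠ 0} := by
  ext e
  have he := e.2
  have hx1 : b x = 1 := by have := hb x; omega
  simp only [cells, Set.mem_ofPred, Finset.mem_insert, Finset.mem_erase, supportBelow,
    Finset.mem_filter, Finset.mem_range]
  rcases eq_or_ne (e : ℕ) y with h | h
  · simp [h, hy]
  · rcases eq_or_ne (e : ℕ) x with h' | h'
    · simp [h', hxy, hx1]
    · simp only [h, h', Function.update_of_ne, ne_eq, not_false_eq_true, false_or, true_and,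
        and_iff_right_iff_imp]
      omega

/-- An exchange keeps the size, so in the truncation independence of the new set is the same as
being a basis. -/
lemma oracleAdj_iff (hnN : n ≤ N) (hb : ∀ i, b i ≤ 1)
    (hS : ∀ j, (M j).Indep (cells n (supportBelow N b))) {u v : ℕ} (hu : u < N) (hv : v < N) :
    OracleAdj M b u v ↔ (exchangeDigraph
      (freeTruncation (M 0) N (supportBelow N b).card)
      (freeTruncation (M 1) N (supportBelow N b).card) (supportBelow N b)).Adj u v := by
  set S := supportBelow N b with hSdef
  have hSN : S ⊆ Finset.range N := Finset.filter_subset _ _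
  have hmem : ∀ i < N, (i ∈ S ↔ b i ≠ 0) := fun i hi => by simp [hSdef, supportBelow, hi]
  have hbase : ∀ (j : Fin 2) (x y : ℕ), x ∈ S → y ∉ S → y < N →
      ((freeTruncation (M j) N S.card).IsBase (insert y ((S : Set ℕ) \ {x})) ↔
        (M j).Indep (cells n (insert y (S.erase x)))) := by
    intro j x y hx hy hyN
    have : insert y ((S : Set ℕ) \ {x}) = (insert y (S.erase x) : Finset ℕ) := by simp
    rw [this, freeTruncation_isBase (hS j) hSN]
    refine and_iff_left ⟨?_, ?_⟩
    · rw [Finset.card_insert_of_notMem (by simp [hy]), Finset.card_erase_add_one hx]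
    · exact Finset.insert_subset (by simpa using hyN) ((Finset.erase_subset _ _).trans hSN)
  change _ ↔ (u ∈ S ∧ v ∉ S ∧ _) ∨ (u ∉ S ∧ v ∈ S ∧ _)
  by_cases huS : u ∈ S
  · by_cases hvS : v ∈ S
    · have h1 := (hmem u hu).1 huS
      have h2 := (hmem v hv).1 hvS
      have h3 := hb u
      have h4 := hb v
      simp only [huS, hvS, not_true_eq_false, false_and, and_false, or_self, iff_false]
      exact fun h => h.1 (by omega)
    · have h1 := (hmem u hu).1 huS
      have h2 : b v = 0 := by simpa using (hmem v hv).not.1 hvS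
      simp only [huS, hvS, not_true_eq_false, not_false_eq_true, true_and, false_and, or_false]
      rw [hbase 0 u v huS hvS hv, cells_exchange hnN (fun h => hvS (by rwa [← h])) hb h1 h2]
      simp only [OracleAdj, h1, if_false]
      exact and_iff_right (by omega)
  · by_cases hvS : v ∈ S
    · have h1 : b u = 0 := by simpa using (hmem u hu).not.1 huS
      have h2 := (hmem v hv).1 hvS
      simp only [huS, hvS, not_true_eq_false, not_false_eq_true, true_and, false_and, false_or]
      have hne : v ≠ u := fun h => huS (by rwa [← h])
      rw [hbase 1 v u hvS huS hu, cells_exchange hnN hne hb h2 h1, OracleAdj, if_pos h1,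
        Function.update_comm hne]
      exact and_iff_right (by omega)
    · have h1 : b u = 0 := by simpa using (hmem u hu).not.1 huS
      have h2 : b v = 0 := by simpa using (hmem v hv).not.1 hvS
      simp only [huS, hvS, false_and, and_false, or_self, iff_false]
      exact fun h => h.1 (by omega)

/-- Whenever `n` is a vertex, it belongs to the current set, and arcs into the current set carry
negated labels. The entry `-1` of `elementLabel` thus becomes `+1`, and the program can store the
integer part as a natural number. -/
lemma oracleLabel_eq {v : ℕ} (hn : n < N → b n ≠ 0) (hv : v < N) :
    oracleLabel n b L v = vertexLabel (elementLabel n L) (supportBelow N b) v := by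
  by_cases hb : b v = 0
  · have hvn : v ≠ n := by
      rintro rfl
      exact hn hv hb
    simp [oracleLabel, vertexLabel, elementLabel, supportBelow, hb, hvn]
  · by_cases hvn : v = n
    · subst hvn
      simp [oracleLabel, vertexLabel, elementLabel, supportBelow, hb, hv]
    · simp [oracleLabel, vertexLabel, elementLabel, supportBelow, hb, hv, hvn]

/-- An improvement step replaces the current common independent set by one of the same size and with
a different label, if there is one. -/
lemma runs_improveProgram_of_commonIndep (h2 : ∀ g : Γ, g + g = 0 → g = 0)
    (h0 : s.nat 0 0 = n)
    (hN : s.nat 3 0 = N) (hnN : n ≤ N) (hb : ∀ i, s.nat 2 i ≤ 1) (hn : n < N → s.nat 2 n ≠ 0)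
    (hS : CommonIndep M N (supportBelow N (s.nat 2))) :
    Runs M improveProgram s (improveTime N) fun s' => (∀ i, s'.nat 2 i ≤ 1) ∧
      ((s'.nat 14 0 = 0 ∧ s'.nat 2 = s.nat 2 ∧ ∀ S', CommonIndep M N S' →
          S'.card = (supportBelow N (s.nat 2)).card →
          setLabel (elementLabel n (s.group 1)) S' =
            setLabel (elementLabel n (s.group 1)) (supportBelow N (s.nat 2))) ∨
        (s'.nat 14 0 ≠ 0 ∧ CommonIndep M N (supportBelow N (s'.nat 2)) ∧
          (supportBelow N (s'.nat 2)).card = (supportBelow N (s.nat 2)).card ∧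
          setLabel (elementLabel n (s.group 1)) (supportBelow N (s'.nat 2)) ≠
            setLabel (elementLabel n (s.group 1)) (supportBelow N (s.nat 2)))) := by
  set b := s.nat 2 with hbdef
  set S := supportBelow N b with hSdef
  set ψ := elementLabel n (s.group 1) with hψ
  have hSN : S ⊆ Finset.range N := Finset.filter_subset _ _
  -- The exchange theorem is applied over `Γ × ℤ`; the integers are torsion-free.
  have h2' : ∀ g : Γ × ℤ, g + g = 0 → g = 0 := by
    rintro ⟨g, z⟩ h
    rw [Prod.mk_add_mk, Prod.mk_eq_zero] at h
    exact Prod.mk_eq_zero.2 ⟨h2 g h.1, by omega⟩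
  have hbase : ∀ T : Finset ℕ, IsCommonBasis (freeTruncation (M 0) N S.card)
      (freeTruncation (M 1) N S.card) T ↔ CommonIndep M N T ∧ T.card = S.card := by
    intro T
    rw [IsCommonBasis, freeTruncation_isBase (hS.2 0) hSN, freeTruncation_isBase (hS.2 1) hSN,
      CommonIndep, Fin.forall_fin_two]
    tauto
  have hSB := (hbase S).2 ⟨hS, rfl⟩
  have hcongr : ∀ W ⊆ Finset.range N, (HasNonZeroClosedWalk (restrictRel (OracleAdj M b) W)
      (oracleLabel n b (s.group 1)) ↔ HasNonZeroClosedWalk (restrictRel (exchangeDigraph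
        (freeTruncation (M 0) N S.card) (freeTruncation (M 1) N S.card) S).Adj W)
        (vertexLabel ψ S)) := fun W hW => hasNonZeroClosedWalk_congr
    (fun u hu v hv => oracleAdj_iff hnN hb hS.2 (Finset.mem_range.1 (hW hu))
      (Finset.mem_range.1 (hW hv)))
    fun u hu => oracleLabel_eq hn (Finset.mem_range.1 (hW hu))
  refine (runs_improveProgram h0 hN hb).mono le_rfl ?_
  rintro s' (⟨h14, hb', hno⟩ | ⟨h14, W, hW, hnz, hmin, hb'⟩)
  · refine ⟨fun i => by rw [hb']; exact hb i, .inl ⟨h14, hb', fun S' hS' hc => ?_⟩⟩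
    by_contra hne
    -- A set of the same size and different label would produce a non-zero closed walk inside the
    -- symmetric difference.
    have := hSB.hasNonZeroClosedWalk ((hbase S').2 ⟨hS', hc⟩) hne
    refine hno ((hcongr _ subset_rfl).2 (this.mono (restrictRel.mono ?_)))
    exact fun i hi => (Finset.mem_symmDiff.1 hi).elim (fun h => hSN h.1) fun h => hS'.1 h.1
  · rw [hcongr W hW] at hnz
    have hmin' := fun w hw h => hmin w hw
      ((hcongr (W.erase w) ((Finset.erase_subset _ _).trans hW)).2 h)
    obtain ⟨h3, h4⟩ := hSB.symmDiff_of_minimal h2' W hnz hmin'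
    have hsupp : supportBelow N (s'.nat 2) = symmDiff S W := by
      ext i
      have hi1 := hb i
      by_cases hiW : i ∈ W
      · have hiN := Finset.mem_range.1 (hW hiW)
        simp only [Finset.mem_symmDiff, hSdef, supportBelow, Finset.mem_filter, Finset.mem_range,
          hiN, hb', hiW, if_true, true_and, ← hbdef]
        simp only [not_true_eq_false, and_false, false_or]
        omega
      · simp [Finset.mem_symmDiff, hSdef, supportBelow, hb', hiW, ← hbdef]
    rw [hbase] at h3
    refine ⟨fun i => ?_, .inr ⟨h14, ?_⟩⟩
    · rw [hb' i]
      have := hb i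
      split_ifs <;> omega
    · rw [hsupp]
      exact ⟨h3.1, h3.2, h4⟩

end Improve

/-! ### The main program -/

/-- Make the set in the array `2` a common independent set of maximal size. The number `n` serves as
an additional free element. -/
def maximizeProgram : Program :=
  .seq (.setNat 3 (.lit 0) (.add (.var 0) (.lit 1)))
    (forLoop 15 0 (.seq (.setNat 2 (.var 0) (.lit 1)) improveProgram))

/-- Remove the additional element. -/
def resetProgram : Program :=
  .seq (.setNat 2 (.var 0) (.lit 0))
    (.seq (.setNat 3 (.lit 0) (.var 0)) (.setNat 18 (.lit 0) (.lit 0)))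

/-- Copy the labels of the input to the group array `1`. -/
def copyProgram : Program := forLoop 17 0 (.setGroup 1 (.var 17) (.get 0 (.var 17)))

/-- Compute in the flag `18` whether some element can be added to the set in the array `2` such that
it remains independent in one of the matroids. -/
def extendProgram : Program :=
  forLoop 17 0 (.cond (.get 2 (.var 17)) .skip
    (.seq (.setNat 2 (.var 17) (.lit 1))
    (.seq (.indep 0 13 (.lit 0) 2)
    (.seq (.indep 1 19 (.lit 0) 2)
    (.seq (.setNat 2 (.var 17) (.lit 0))
      (.cond (.add (.var 13) (.var 19)) (.setNat 18 (.lit 0) (.lit 1)) .skip))))))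

/-- Compute in the flag `16` whether the label of the set in the array `2` is zero. -/
def sumProgram : Program :=
  .seq (.setGroup 3 (.lit 0) .zero)
    (.seq (forLoop 17 0 (.cond (.get 2 (.var 17))
      (.setGroup 3 (.lit 0) (.add (.get 3 (.lit 0)) (.get 1 (.var 17)))) .skip))
      (.isZero 16 (.lit 0) (.get 3 (.lit 0))))

/-- Improve the set in the array `2` if its label is zero, and write the answer. -/
def answerProgram : Program :=
  .cond (.var 18) (.setNat 1 (.lit 0) (.lit 0))
    (.cond (.var 16) (.seq improveProgram (.setNat 1 (.lit 0) (.var 14)))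
      (.setNat 1 (.lit 0) (.lit 1)))

/-- The program for Non-Zero Common Basis. -/
def nonZeroCommonBasisProgram : Program :=
  .seq maximizeProgram (.seq resetProgram (.seq copyProgram (.seq extendProgram
    (.seq sumProgram answerProgram))))

/-! ### Correctness of the phases of the main program. -/

section Main

variable {n : ℕ} {Γ : Type*} [AddCommGroup Γ] {M : Fin 2 → Matroid (Fin n)} {s : Store Γ}
  {ψ : Fin n → Γ}

/-- `I` is a common independent set of maximal size. -/
def IsMaxCommonIndep (M : Fin 2 → Matroid (Fin n)) (I : Finset ℕ) : Prop :=
  CommonIndep M n I ∧ ∀ S, CommonIndep M n S → S.card ≤ I.card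

/-- With zero group labels, a change of label means exactly a change in the membership of `n`. -/
lemma setLabel_elementLabel_zero (S : Finset ℕ) :
    setLabel (elementLabel n (0 : ℕ → Γ)) S = (0, if n ∈ S then -1 else 0) := by
  rw [setLabel]
  ext
  · simp [elementLabel, Prod.fst_sum]
  · simp [elementLabel, Prod.snd_sum]

lemma setLabel_elementLabel_of_subset {L : ℕ → Γ} {S : Finset ℕ} (hS : S ⊆ Finset.range n) :
    setLabel (elementLabel n L) S = (∑ i ∈ S, L i, 0) := by
  rw [setLabel]
  ext
  · simp [elementLabel, Prod.fst_sum]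
  · simp only [elementLabel, Prod.snd_sum]
    exact Finset.sum_eq_zero fun i hi => if_neg (Finset.mem_range.1 (hS hi)).ne

lemma supportBelow_succ_of_ne_zero {b : ℕ → ℕ} (h : b n ≠ 0) :
    supportBelow (n + 1) b = insert n (supportBelow n b) := by
  rw [supportBelow, Finset.range_add_one, Finset.filter_insert, if_pos h]
  rfl

lemma supportBelow_congr {b b' : ℕ → ℕ} (h : ∀ i < n, b i = b' i) :
    supportBelow n b = supportBelow n b' :=
  Finset.filter_congr fun i hi => by rw [h i (Finset.mem_range.1 hi)]

lemma notMem_supportBelow (b : ℕ → ℕ) : n ∉ supportBelow n b := by simp [supportBelow]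

lemma cells_insert_self (S : Finset ℕ) : cells n (insert n S) = cells n S := by
  ext x
  have := x.2
  simp only [cells, Set.mem_ofPred, Finset.mem_insert, or_iff_right_iff_imp]
  omega

/-- For a common independent set `I`, the set `I + n` has size `|I| + 1`. A set of the same size and
different label avoids `n`, hence is a larger common independent set of the original matroids. The
group labels must still be zero in this phase, so the input labels are copied only afterwards. -/
lemma runs_maximizeProgram (h2 : ∀ g : Γ, g + g = 0 → g = 0) (h0 : s.nat 0 0 = n)
    (hs2 : s.nat 2 = 0) (hs1 : s.group 1 = 0) :
    Runs M maximizeProgram s (n * (improveTime (n + 1) + 16) + 20) fun s' =>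
      (∀ i, s'.nat 2 i ≤ 1) ∧ IsMaxCommonIndep M (supportBelow n (s'.nat 2)) := by
  refine Runs.mono (T := 6 + (n * (4 + improveTime (n + 1) + 12) + 9)) (A := _) ?_
    (by rw [show 4 + improveTime (n + 1) + 12 = improveTime (n + 1) + 16 by omega]; omega)
    fun _ h => h
  refine Runs.seq (A := fun s₁ => s₁ = s.writeNat 3 0 (n + 1)) (Runs.of_loopFree rfl (by decide)
    (by simp [Program.eff, NatExpr.eval, h0])) ?_
  rintro _ rfl
  refine (Runs.forLoop (i := 15) (b := 0) (s := s.writeNat 3 0 (n + 1)) (P := .seq (.setNat 2 (.var 0) (.lit 1)) improveProgram) n (fun k s' => s'.group 1 = 0 ∧ (∀ i, s'.nat 2 i ≤ 1) ∧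
      CommonIndep M n (supportBelow n (s'.nat 2)) ∧ (k ≤ (supportBelow n (s'.nat 2)).card ∨
        IsMaxCommonIndep M (supportBelow n (s'.nat 2)))) h0 rfl rfl (fun k s v h => h)
        ⟨hs1, ?_, ?_, ?_⟩ ?_).mono le_rfl ?_
  · intro i
    simp [Store.writeNat, hs2]
  · refine ⟨Finset.filter_subset _ _, fun j => ?_⟩
    have : cells n (supportBelow n ((s.writeNat 3 0 (n + 1)).nat 2)) = ∅ := by
      ext e
      simp [cells, supportBelow, Store.writeNat, hs2]
    rw [this]
    exact (M j).empty_indep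
  · exact .inl (Nat.zero_le _)
  · rintro k hk s₁ e₁ ag₁ ⟨hg, hb, hI, hcard⟩
    have e0 : s₁.nat 0 0 = n := by rw [ag₁.1 0 rfl]; exact h0
    have e3 : s₁.nat 3 0 = n + 1 := by rw [ag₁.1 3 rfl]; simp [Store.writeNat]
    set I := supportBelow n (s₁.nat 2) with hIdef
    refine Runs.seq (A := fun s₂ => s₂ = s₁.writeNat 2 n 1) (Runs.of_loopFree rfl (by decide)
      (by simp [Program.eff, NatExpr.eval, e0])) ?_
    rintro _ rfl
    have hw : ∀ i, (s₁.writeNat 2 n 1).nat 2 i = if i = n then 1 else s₁.nat 2 i := fun i => by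
      simp [Store.writeNat, Function.update_apply]
    have hlow : supportBelow n ((s₁.writeNat 2 n 1).nat 2) = I :=
      supportBelow_congr fun i hi => by rw [hw, if_neg hi.ne]
    have hsupp : supportBelow (n + 1) ((s₁.writeNat 2 n 1).nat 2) = insert n I := by
      rw [supportBelow_succ_of_ne_zero (by rw [hw]; simp), hlow]
    have hnI : n ∉ I := notMem_supportBelow _
    have hins : CommonIndep M (n + 1) (insert n I) := by
      refine ⟨Finset.insert_subset (by simp) (hI.1.trans (Finset.range_subset_range.2 (by omega))),
        fun j => ?_⟩
      rw [cells_insert_self]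
      exact hI.2 j
    refine (runs_improveProgram_of_commonIndep (M := M) (s := s₁.writeNat 2 n 1) h2 e0 e3 (by omega) (fun i => ?_)
      (fun _ => by rw [hw]; simp) (by rw [hsupp]; exact hins)).agree.mono le_rfl ?_
    · rw [hw]
      split_ifs
      · rfl
      · exact hb i
    rintro s₂ ⟨⟨hb₂, hcase⟩, ag₂⟩
    have hg₂ : s₂.group 1 = 0 := by rw [ag₂.2 1 rfl]; exact hg
    refine ⟨hg₂, hb₂, ?_⟩
    have hg₁ : (s₁.writeNat 2 n 1).group 1 = 0 := hg
    rw [hsupp, hg₁, setLabel_elementLabel_zero] at hcase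
    rcases hcase with ⟨-, he, hall⟩ | ⟨-, hS, hc, hl⟩
    · rw [he, hlow]
      refine ⟨hI, .inr ⟨hI, fun S hS => ?_⟩⟩
      by_contra hlt
      push Not at hlt
      -- A larger common independent set can be cut down to size `|I| + 1`. It avoids `n`, so its
      -- label differs from that of `I + n`, although no improvement exists.
      obtain ⟨T, hTS, hTc⟩ := Finset.exists_subset_card_eq (Nat.succ_le_of_lt hlt)
      have hT : CommonIndep M (n + 1) T :=
        ⟨(hTS.trans hS.1).trans (Finset.range_subset_range.2 (by omega)),
          fun j => (hS.2 j).subset (cells_mono hTS)⟩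
      have := hall T hT (by rw [hTc, Finset.card_insert_of_notMem hnI])
      have hnT : n ∉ T := fun h => by simpa using hS.1 (hTS h)
      rw [setLabel_elementLabel_zero] at this
      simp [hnT] at this
    -- The label has changed, so `n` was dropped and the new set of size `|I| + 1` lies below `n`.
    · have hnS : n ∉ supportBelow (n + 1) (s₂.nat 2) := by
        intro h
        rw [setLabel_elementLabel_zero] at hl
        simp [h] at hl
      have heq : supportBelow (n + 1) (s₂.nat 2) = supportBelow n (s₂.nat 2) := by
        rw [supportBelow, Finset.range_add_one, Finset.filter_insert, if_neg]
        · rfl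
        · simpa [supportBelow] using hnS
      rw [heq] at hS hc
      rw [Finset.card_insert_of_notMem hnI] at hc
      have hS' : CommonIndep M n (supportBelow n (s₂.nat 2)) :=
        ⟨Finset.filter_subset _ _, hS.2⟩
      refine ⟨hS', .inl ?_⟩
      rcases hcard with h | h
      · omega
      · have := h.2 _ hS'
        omega
  · rintro s' ⟨-, hb, hI, h | h⟩
    · refine ⟨hb, hI, fun S hS => ?_⟩
      have := Finset.card_le_card hS.1
      rw [Finset.card_range] at this
      omega
    · exact ⟨hb, h⟩

lemma runs_copyProgram (h0 : s.nat 0 0 = n) : Runs M copyProgram s (n * 20 + 9) fun s' =>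
    ∀ i < n, s'.group 1 i = s.group 0 i := by
  refine Runs.forLoop (i := 17) (T := 8) n (fun k s' => ∀ i < k, s'.group 1 i = s.group 0 i) h0
    rfl rfl (fun k s v h => h) (by simp) fun k hk s₁ e₁ ag₁ h => ?_
  refine Runs.of_loopFree rfl (by decide) fun i hi => ?_
  have e0 : s₁.group 0 = s.group 0 := ag₁.2 0 rfl
  simp only [Program.eff, NatExpr.eval, GroupExpr.eval, e₁, e0, Store.writeGroup,
    Function.update_self]
  rcases eq_or_ne i k with rfl | hne
  · simp
  · rw [Function.update_of_ne hne]
    exact h i (by omega)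

lemma runs_extendProgram (h0 : s.nat 0 0 = n) (h18 : s.nat 18 0 = 0) :
    Runs M extendProgram s (n * 60 + 9) fun s' => s'.nat 2 = s.nat 2 ∧
      (s'.nat 18 0 ≠ 0 ↔ ∃ y < n, s.nat 2 y = 0 ∧
        ∃ j, (M j).Indep (cells n (insert y (supportBelow n (s.nat 2))))) := by
  classical
  refine Runs.forLoop (i := 17) (T := 48) n (fun k s' => s'.nat 2 = s.nat 2 ∧
      (s'.nat 18 0 ≠ 0 ↔ ∃ y < k, s.nat 2 y = 0 ∧
        ∃ j, (M j).Indep (cells n (insert y (supportBelow n (s.nat 2)))))) h0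
    rfl rfl (fun k s v h => h) ⟨rfl, by simp [h18]⟩ fun k hk s₁ e₁ ag₁ ⟨e2, h⟩ => ?_
  refine Runs.of_loopFree rfl (by decide) ?_
  by_cases hk2 : s.nat 2 k = 0
  swap
  · simp only [Program.eff, NatExpr.eval, e₁, e2, hk2, if_false]
    refine ⟨trivial, h.trans ⟨fun ⟨y, hy, h'⟩ => ⟨y, by omega, h'⟩, fun ⟨y, hy, h'⟩ => ⟨y, ?_, h'⟩⟩⟩
    have : y ≠ k := by
      rintro rfl
      exact hk2 h'.1
    omega
  have hset : ∀ j, (M j).Indep {e : Fin n | Function.update (s.nat 2) k 1 e ≠ 0} ↔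
      (M j).Indep (cells n (insert k (supportBelow n (s.nat 2)))) := by
    intro j
    have : {e : Fin n | Function.update (s.nat 2) k 1 e ≠ 0} =
        cells n (insert k (supportBelow n (s.nat 2))) := by
      ext e
      rcases eq_or_ne (e : ℕ) k with he | he
      · simp [cells, he]
      · simp [cells, supportBelow, he]
    rw [this]
  have hback : Function.update (Function.update (s.nat 2) k 1) k 0 = s.nat 2 := by
    rw [Function.update_idem, ← hk2, Function.update_eq_self]
  have hstep : (∃ y < k + 1, s.nat 2 y = 0 ∧
        ∃ j, (M j).Indep (cells n (insert y (supportBelow n (s.nat 2))))) ↔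
      (s₁.nat 18 0 ≠ 0 ∨ ∃ j, (M j).Indep (cells n (insert k (supportBelow n (s.nat 2))))) := by
    rw [h]
    constructor
    · rintro ⟨y, hy, h'⟩
      rcases Nat.lt_succ_iff_lt_or_eq.1 hy with hy | rfl
      · exact .inl ⟨y, hy, h'⟩
      · exact .inr h'.2
    · rintro (⟨y, hy, h'⟩ | h')
      · exact ⟨y, by omega, h'⟩
      · exact ⟨k, by omega, hk2, h'⟩
  rw [hstep, Fin.exists_fin_two, ← hset 0, ← hset 1]
  by_cases i0 : (M 0).Indep {e : Fin n | Function.update (s.nat 2) k 1 e ≠ 0}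
  · by_cases i1 : (M 1).Indep {e : Fin n | Function.update (s.nat 2) k 1 e ≠ 0} <;>
    simp only [ne_eq] at i0 i1 <;>
    simp [Program.eff, NatExpr.eval, Store.writeNat, Store.readSet, e₁, e2, hk2, hback, i0, i1]
  · by_cases i1 : (M 1).Indep {e : Fin n | Function.update (s.nat 2) k 1 e ≠ 0} <;>
    simp only [ne_eq] at i0 i1 <;>
    simp [Program.eff, NatExpr.eval, Store.writeNat, Store.readSet, e₁, e2, hk2, hback, i0, i1]

open Classical in
lemma runs_sumProgram (h0 : s.nat 0 0 = n) : Runs M sumProgram s (n * 40 + 20) fun s' =>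
    s'.nat 16 0 = if ∑ i ∈ supportBelow n (s.nat 2), s.group 1 i = 0 then 1 else 0 := by
  refine Runs.mono (T := 3 + (n * (28 + 12) + 9 + 8)) (A := _) ?_ (by omega) fun _ h => h
  refine Runs.seq (A := fun s₁ => s₁ = s.writeGroup 3 0 0) (Runs.of_loopFree rfl (by decide)
    (by simp [Program.eff, NatExpr.eval, GroupExpr.eval])) ?_
  rintro _ rfl
  refine Runs.seq (Runs.forLoop (i := 17) (T := 28) n (fun k s' => s'.group 3 0 =
    ∑ i ∈ supportBelow k (s.nat 2), s.group 1 i) h0 rfl rfl (fun k s v h => h) ?_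
    fun k hk s₁ e₁ ag₁ h => ?_) fun s₁ h => Runs.of_loopFree rfl (by decide) ?_
  · simp [Store.writeGroup, supportBelow]
  · refine Runs.of_loopFree rfl (by decide) ?_
    have e2 : s₁.nat 2 = s.nat 2 := ag₁.1 2 rfl
    have eg : s₁.group 1 = s.group 1 := ag₁.2 1 rfl
    simp only [Program.eff, NatExpr.eval, GroupExpr.eval, e₁, e2, eg, h]
    by_cases hk2 : s.nat 2 k = 0
    · rw [if_pos hk2, h, supportBelow, supportBelow, Finset.range_add_one, Finset.filter_insert,
        if_neg (by simpa using hk2)]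
    · rw [if_neg hk2, supportBelow_succ_of_ne_zero hk2,
        Finset.sum_insert (notMem_supportBelow _), add_comm]
      simp [Store.writeGroup]
  · simp [Program.eff, NatExpr.eval, GroupExpr.eval, Store.writeNat, h]

/-! ### Correctness -/

lemma cells_map_val (B : Finset (Fin n)) : cells n (B.map Fin.valEmbedding) = B := by
  ext e
  simp [cells, Fin.val_inj]

lemma sum_map_val (B : Finset (Fin n)) {L : ℕ → Γ} (hL : ∀ i : Fin n, L i = ψ i) :
    ∑ i ∈ B.map Fin.valEmbedding, L i = setLabel ψ B := by
  rw [Finset.sum_map, setLabel]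
  exact Finset.sum_congr rfl fun i _ => hL i

omit [AddCommGroup Γ] in
lemma map_val_readSet (s : Store Γ) :
    (s.readSet n 2).map Fin.valEmbedding = supportBelow n (s.nat 2) := by
  ext i
  simp only [Finset.mem_map, Store.readSet, Finset.mem_filter, Finset.mem_univ, true_and,
    supportBelow, Finset.mem_range, Fin.valEmbedding_apply]
  constructor
  · rintro ⟨e, he, rfl⟩
    exact ⟨e.2, he⟩
  · rintro ⟨h1, h2⟩
    exact ⟨⟨i, h1⟩, h2, rfl⟩

lemma commonIndep_map_val {B : Finset (Fin n)} :
    CommonIndep M n (B.map Fin.valEmbedding) ↔ ∀ j, (M j).Indep (B : Set (Fin n)) := by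
  rw [CommonIndep, cells_map_val]
  refine and_iff_right fun i hi => ?_
  obtain ⟨e, -, rfl⟩ := Finset.mem_map.1 hi
  simp

/-- A common independent set of maximal size to which no element can be added in either matroid is a
common basis. Otherwise there is no common basis. -/
lemma IsMaxCommonIndep.isCommonBasis_iff {I : Finset (Fin n)}
    (hI : IsMaxCommonIndep M (I.map Fin.valEmbedding)) :
    ((∃ y < n, y ∉ I.map Fin.valEmbedding ∧
      ∃ j, (M j).Indep (cells n (insert y (I.map Fin.valEmbedding)))) →
        ¬ ∃ B : Finset (Fin n), IsCommonBasis (M 0) (M 1) B) ∧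
    ((¬ ∃ y < n, y ∉ I.map Fin.valEmbedding ∧
      ∃ j, (M j).Indep (cells n (insert y (I.map Fin.valEmbedding)))) →
        IsCommonBasis (M 0) (M 1) I) := by
  have hIj := commonIndep_map_val.1 hI.1
  have hcells : ∀ y : Fin n, cells n (insert (y : ℕ) (I.map Fin.valEmbedding)) =
      insert y (I : Set (Fin n)) := by
    intro y
    ext e
    simp [cells, Fin.val_inj]
  constructor
  · rintro ⟨y, hy, hyI, j, hj⟩ ⟨B, hB⟩
    have hBj : ∀ j, (M j).IsBase (B : Set (Fin n)) := Fin.forall_fin_two.2 hB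
    -- A common basis `B` has at most `|I|` elements, whereas the independent set `I + y` forces the
    -- rank of matroid `j`, which is `|B|`, to be at least `|I| + 1`.
    have h1 := hI.2 _ (commonIndep_map_val.2 fun j => (hBj j).indep)
    rw [Finset.card_map, Finset.card_map] at h1
    rw [hcells ⟨y, hy⟩] at hj
    have hyI' : (⟨y, hy⟩ : Fin n) ∉ I := fun h => hyI (Finset.mem_map.2 ⟨_, h, rfl⟩)
    have h2 := hj.encard_le_eRank
    rw [← (hBj j).encard_eq_eRank, ← Finset.coe_insert, Set.encard_coe_eq_coe_finsetCard,
      Set.encard_coe_eq_coe_finsetCard, Nat.cast_le, Finset.card_insert_of_notMem hyI'] at h2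
    omega
  · intro hno
    have : ∀ j, (M j).IsBase (I : Set (Fin n)) := fun j =>
      (hIj j).isBase_of_forall_insert fun y hy h => by
        rw [← hcells] at h
        exact hno ⟨y, y.2, by simpa [Fin.val_inj] using hy.2, j, h⟩
    exact ⟨this 0, this 1⟩

/-- The running time of `nonZeroCommonBasisProgram`. -/
def totalTime (n : ℕ) : ℕ :=
  n * (improveTime (n + 1) + 16) + n * 120 + improveTime n + 100

/-- A common independent set of maximal size either shows that no common basis exists or is itself
one. If its label is zero, a single improvement step decides the instance: sets of the same size
that are independent in both matroids are common bases, and a label different from zero is what is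
sought. -/
theorem runs_nonZeroCommonBasisProgram (h2 : ∀ g : Γ, g + g = 0 → g = 0) :
    Runs M nonZeroCommonBasisProgram (inputStore ψ) (totalTime n) (IsCorrectOutput M ψ) := by
  classical
  refine Runs.mono (T := n * (improveTime (n + 1) + 16) + 20 + (20 + (n * 20 + 9 + (n * 60 + 9 +
    (n * 40 + 20 + (3 + (3 + (improveTime n + 4)))))))) (A := _) ?_ (by unfold totalTime; omega)
    fun _ h => h
  refine Runs.seq (runs_maximizeProgram h2 (s := inputStore ψ) (n := n) (by simp [inputStore])
    (by funext i; simp [inputStore]) (by funext i; simp [inputStore])).agree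
    fun s₁ ⟨⟨hb₁, hI₁⟩, ag₁⟩ => ?_
  have e0 : s₁.nat 0 0 = n := by rw [ag₁.1 0 rfl]; simp [inputStore]
  have hψ : ∀ i : Fin n, s₁.group 0 i = ψ i := fun i => by
    rw [ag₁.2 0 rfl]
    simp [inputStore]
  refine Runs.seq (A := fun s₂ => s₂ = ((s₁.writeNat 2 n 0).writeNat 3 0 n).writeNat 18 0 0)
    (Runs.of_loopFree rfl (by decide) ?_) ?_
  · simp [resetProgram, Program.eff, NatExpr.eval, e0, Store.writeNat]
  rintro s₂ hs₂
  have hb₂ : ∀ i, s₂.nat 2 i ≤ 1 := fun i => by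
    have : s₂.nat 2 = Function.update (s₁.nat 2) n 0 := by rw [hs₂]; rfl
    rw [this, Function.update_apply]
    split_ifs
    · exact Nat.zero_le _
    · exact hb₁ i
  have hI₂ : supportBelow n (s₂.nat 2) = supportBelow n (s₁.nat 2) := supportBelow_congr fun i hi => by
    simp [hs₂, Store.writeNat, hi.ne]
  rw [← hI₂] at hI₁
  have e0₂ : s₂.nat 0 0 = n := by rw [hs₂]; exact e0
  have e3₂ : s₂.nat 3 0 = n := by rw [hs₂]; rfl
  have e18₂ : s₂.nat 18 0 = 0 := by rw [hs₂]; rfl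
  have hψ₂ : ∀ i : Fin n, s₂.group 0 i = ψ i := fun i => by rw [hs₂]; exact hψ i
  refine Runs.seq (runs_copyProgram e0₂).agree fun s₃ ⟨h₃, ag₃⟩ => ?_
  have hψ₃ : ∀ i : Fin n, s₃.group 1 i = ψ i := fun i => (h₃ i i.2).trans (hψ₂ i)
  have e2₃ : s₃.nat 2 = s₂.nat 2 := ag₃.1 2 rfl
  have e0₃ : s₃.nat 0 0 = n := by rw [ag₃.1 0 rfl, e0₂]
  refine Runs.seq (runs_extendProgram (M := M) e0₃ (by rw [ag₃.1 18 rfl, e18₂])).agree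
    fun s₄ ⟨⟨e2₄, h18⟩, ag₄⟩ => ?_
  have e0₄ : s₄.nat 0 0 = n := by rw [ag₄.1 0 rfl, e0₃]
  have hψ₄ : ∀ i : Fin n, s₄.group 1 i = ψ i := fun i => by rw [ag₄.2 1 rfl, hψ₃]
  refine Runs.seq (runs_sumProgram e0₄).agree fun s₅ ⟨h16, ag₅⟩ => ?_
  have e2₅ : s₅.nat 2 = s₂.nat 2 := by rw [ag₅.1 2 rfl, e2₄, e2₃]
  have e0₅ : s₅.nat 0 0 = n := by rw [ag₅.1 0 rfl, e0₄]
  have e3₅ : s₅.nat 3 0 = n := by rw [ag₅.1 3 rfl, ag₄.1 3 rfl, ag₃.1 3 rfl, e3₂]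
  have hψ₅ : ∀ i : Fin n, s₅.group 1 i = ψ i := fun i => by rw [ag₅.2 1 rfl, hψ₄]
  have h18₅ : s₅.nat 18 0 = s₄.nat 18 0 := by rw [ag₅.1 18 rfl]
  have hI : IsMaxCommonIndep M (supportBelow n (s₅.nat 2)) := by rwa [e2₅]
  have hext : s₅.nat 18 0 ≠ 0 ↔ ∃ y < n, y ∉ supportBelow n (s₅.nat 2) ∧
      ∃ j, (M j).Indep (cells n (insert y (supportBelow n (s₅.nat 2)))) := by
    rw [h18₅, h18, e2₃, ← e2₅]
    refine exists_congr fun y => and_congr_right fun hy => and_congr_left fun _ => ?_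
    simp [supportBelow, hy]
  have hz : s₅.nat 16 0 ≠ 0 ↔ setLabel ψ (s₅.readSet n 2) = 0 := by
    rw [h16, ← sum_map_val _ hψ₄, map_val_readSet, ag₅.1 2 rfl]
    simp
  obtain ⟨hno, hyes⟩ := IsMaxCommonIndep.isCommonBasis_iff (M := M) (I := s₅.readSet n 2)
    (by rwa [map_val_readSet])
  rw [map_val_readSet, ← hext] at hno hyes
  refine (Runs.cond (T := 3 + (improveTime n + 4)) (fun hc => ?_) fun hc => ?_)
  · refine Runs.of_loopFree rfl ?_ (.inr ⟨rfl, fun ⟨B, hB⟩ => hno hc ⟨B, hB.1⟩⟩)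
    simp only [Program.maxCost, NatExpr.cost]
    omega
  have hbasis := hyes (not_not.2 hc)
  refine Runs.cond (fun hc' => ?_) fun hc' => ?_
  swap
  · refine Runs.of_loopFree rfl ?_ (.inl ⟨one_ne_zero, hbasis, fun h => hz.2 h hc'⟩)
    simp only [Program.maxCost, NatExpr.cost]
    omega
  have hzero := hz.1 hc'
  -- Now `N = n`, so there is no additional element, its membership condition is void and all
  -- integer parts vanish.
  refine Runs.seq (runs_improveProgram_of_commonIndep h2 e0₅ e3₅ le_rfl (by rw [e2₅]; exact hb₂)
    (fun h => absurd h (lt_irrefl n)) hI.1) fun s₆ ⟨_, hcase⟩ => Runs.of_loopFree rfl (by decide) ?_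
  have hsub : ∀ b, supportBelow n b ⊆ Finset.range n := fun b => Finset.filter_subset _ _
  rw [setLabel_elementLabel_of_subset (hsub (s₅.nat 2)), ← map_val_readSet s₅, sum_map_val _ hψ₅,
    hzero, Finset.card_map] at hcase
  rcases hcase with ⟨h14, -, hall⟩ | ⟨h14, hS, hc6, hl⟩
  · refine .inr ⟨h14, ?_⟩
    rintro ⟨B, hB, hne⟩
    refine hne ?_
    have hBI := (commonIndep_map_val (M := M) (B := B)).2
      (Fin.forall_fin_two.2 ⟨hB.1.indep, hB.2.indep⟩)
    have := hall _ hBI (by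
      rw [Finset.card_map, hbasis.1.card_eq_of_finset hB.1])
    rw [setLabel_elementLabel_of_subset hBI.1, sum_map_val _ hψ₅, Prod.mk.injEq] at this
    exact this.1
  · refine .inl ⟨h14, ?_⟩
    change IsNonZeroCommonBasis (M 0) (M 1) ψ (s₆.readSet n 2)
    rw [setLabel_elementLabel_of_subset (hsub _)] at hl
    rw [← map_val_readSet s₆, sum_map_val _ hψ₅] at hl
    rw [← map_val_readSet s₆, commonIndep_map_val] at hS
    rw [← map_val_readSet s₆, Finset.card_map] at hc6
    exact ⟨⟨(hS 0).isBase_of_card_eq hbasis.1 hc6, (hS 1).isBase_of_card_eq hbasis.2 hc6⟩,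
      fun h => hl (by rw [h])⟩

lemma exists_polynomial_totalTime : ∃ p : Polynomial ℕ, ∀ n, p.eval n = totalTime n := by
  let R : Polynomial ℕ := .X * (.X * (.X * 312 + 21) + 21) + 9
  let D : Polynomial ℕ := .X * (R + .X * 17 + 100) + 20
  let I : Polynomial ℕ := (.X + 1) * (D + 100) + .X * 100 + 100
  refine ⟨.X * (I.comp (.X + 1) + 16) + .X * 120 + I + 100, fun n => ?_⟩
  simp [I, D, R, totalTime, improveTime, detectTime, roundsTime]

end Main

/-! ### The main theorem. -/

lemma eq_zero_of_add_self_eq_zero {Γ : Type*} [AddCommGroup Γ] (h : ∀ g : Γ, addOrderOf g ≠ 2)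
    (g : Γ) (hg : g + g = 0) : g = 0 := by
  by_contra hne
  exact h g (addOrderOf_eq_prime (by rwa [two_nsmul]) hne)

theorem mainTheorem1 :
    (∀ (Γ : Type u) [AddCommGroup Γ] (E : Type v) [Fintype E] [DecidableEq E]
      (M₁ M₂ : Matroid E) (ψ : E → Γ) (B₀ : Finset E),
      (∀ g : Γ, addOrderOf g ≠ 2) → M₁.E = Set.univ → M₂.E = Set.univ →
      IsCommonBasis M₁ M₂ B₀ → setLabel ψ B₀ = 0 →
      ((∃ B : Finset E, IsNonZeroCommonBasis M₁ M₂ ψ B) ↔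
        ∃ (k : ℕ) (c : Fin (k + 1) → E), IsDirectedCycle (exchangeDigraph M₁ M₂ B₀) c ∧
          cycleLabel (exchangeLabel ψ B₀) c ≠ 0)) ∧
    ∃ (P : Program) (p : Polynomial ℕ),
      ∀ (Γ : Type u) [AddCommGroup Γ] (n : ℕ) (M : Fin 2 → Matroid (Fin n)) (ψ : Fin n → Γ),
        (∀ g : Γ, addOrderOf g ≠ 2) → (∀ j, (M j).E = Set.univ) →
        ∃ (s : Store Γ) (t : ℕ), Exec M P (inputStore ψ) s t ∧ t ≤ p.eval n ∧
          IsCorrectOutput M ψ s := by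
  refine ⟨fun Γ _ E _ _ M₁ M₂ ψ B₀ h _ _ hB h0 =>
    exists_nonZeroCommonBasis_iff M₁ M₂ ψ B₀ (eq_zero_of_add_self_eq_zero h) hB h0, ?_⟩
  obtain ⟨p, hp⟩ := exists_polynomial_totalTime
  refine ⟨nonZeroCommonBasisProgram, p, fun Γ _ n M ψ h _ => ?_⟩
  rw [hp]
  exact runs_nonZeroCommonBasisProgram (eq_zero_of_add_self_eq_zero h)
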